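/- Let $\mathbb{K}$ be a field of characteristic zero. All species are positive linear species on finite sets and bijections, operads are symmetric linear operads given by a unit and partial compositions $\circ_\ast$, and $\mathbb{K}S$ is the linear species spanned by a set species $S$ (or, for a set of vectors, its linear span). *Graph operads.* A multigraph on $V$ is a multiset of unordered pairs of (possibly equal) elements of $V$; a graph is a multigraph without loops and repeated edges. Let $\mathbf{MG}_c$, $\mathbf{G}_c$, $\mathbf{T}$ be the set species of connected multigraphs, connected graphs and trees (on nonempty vertex sets). For $g_1$ on $V_1\ni\ast$ and $g_2$ on $V_2$, disjoint from $V_1$, the insertion $g_1\circ_\ast g_2$ is the sum, over all ways to choose for each edge end of $g_1$ at $\ast$ a vertex of $V_2$, of the multigraph on $(V_1\setminus\{\ast\})\sqcup V_2$ obtained from $g_1\sqcup g_2$ by moving each edge end at $\ast$ to the chosen vertex. With the insertion, $\mathbb{K}\mathbf{MG}_c$ and its subspecies $\mathbb{K}\mathbf{G}_c$ and $\mathbb{K}\mathbf{T}$ are operads. *Rooted oriented multigraphs.* In an oriented multigraph every edge end is either labelled or unlabelled. Let $\mathbf{MG}_{orc}^\bullet[V]$ be the set of pairs $(g,r)$ of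 a connected oriented multigraph $g$ on $V$ and a root $r\in V$, and $\mathbf{G}_{orc}^\bullet$ its subspecies where the multigraph underlying $g$ is a graph. The rooted insertion $(g_1,r_1)\circ_\ast(g_2,r_2)$ is the sum of all rooted oriented multigraphs obtained in the same way, where unlabelled ends at $\ast$ must be moved to $r_2$, labelled ends at $\ast$ are moved to arbitrary vertices of $V_2$, and the new root is $r_1$ if $r_1\neq\ast$ and $r_2$ otherwise. For a tree $t$ and $r\in V$, let $t_r$ be $t$ with, for each edge, the parent end with respect to the root $r$ labelled and the child end unlabelled. The pre-Lie operad $\mathbf{PLie}$ is the linear span of the $(t_r,r)$, with the rooted insertion. For $g\in\mathbf{MG}_c[V]$, $r\in V$ and a spanning tree $t$ of $g$, let $\overrightarrow{g}^{(t,r)}$ be $g$ with the edges of $t$ oriented as in $t_r$ and with both ends of all other edges labelled. Let $$\mathcal{O}_1[V]=\Big\{\sum_{r\in V}(\overrightarrow{g}^{(t(r),r)},r) : g\in\mathbf{MG}_c[V],\ t(r)\text{ a spanning tree of }g\text{ for each }r\in V\Big\},$$ $$\mathcal{O}_2[V]=\Big\{(\overrightarrow{g}^{(t_1,r)},r)-(\overrightarrow{g}^{(t_2,r)},r)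 : g\in\mathbf{MG}_c[V],\ r\in V,\ t_1,t_2\text{ spanning trees of }g\Big\}.$$ **Proposition.** With the rooted insertion, $\mathbf{PLie}$, $\mathbb{K}\mathcal{O}_1$ and $\mathbb{K}\mathcal{O}_1\cap\mathbb{K}\mathbf{G}_{orc}^\bullet$ are closed under the operad structure, $\mathbb{K}\mathcal{O}_2\subset\mathbb{K}\mathcal{O}_1$ is an ideal of $\mathbb{K}\mathcal{O}_1$, $\mathbb{K}\mathcal{O}_2\cap\mathbb{K}\mathbf{G}_{orc}^\bullet$ is an ideal of $\mathbb{K}\mathcal{O}_1\cap\mathbb{K}\mathbf{G}_{orc}^\bullet$, and $\mathbf{PLie}$ and the two quotients are operads. Moreover: 1. The map $\psi:\mathbb{K}\mathbf{T}\to\mathbf{PLie}$, $\psi(t)=\sum_{r\in V}(t_r,r)$ for $t\in\mathbf{T}[V]$, is a monomorphism of operads with image $\mathbb{K}\mathcal{O}_1\cap\mathbf{PLie}$. 2. It extends to an isomorphism of operads $\psi:\mathbb{K}\mathbf{MG}_c\to\mathbb{K}\mathcal{O}_1/\mathbb{K}\mathcal{O}_2$, that is, for $x\in\mathbb{K}\mathbf{T}[V]$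 the new $\psi(x)$ is the class of the old one. It satisfies, for every $g\in\mathbf{MG}_c[V]$ and every choice of a spanning tree $t(r)$ of $g$ for each $r\in V$, $$\psi(g)=\sum_{r\in V}(\overrightarrow{g}^{(t(r),r)},r)\quad\text{modulo }\mathbb{K}\mathcal{O}_2[V].$$ 3. It restricts to an isomorphism of operads $\mathbb{K}\mathbf{G}_c\to(\mathbb{K}\mathcal{O}_1\cap\mathbb{K}\mathbf{G}_{orc}^\bullet)/(\mathbb{K}\mathcal{O}_2\cap\mathbb{K}\mathbf{G}_{orc}^\bullet)$, where the target maps naturally to $\mathbb{K}\mathcal{O}_1/\mathbb{K}\mathcal{O}_2$. -/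

import Mathlib

universe u v w w'

set_option linter.checkUnivs false

noncomputable section

namespace GraphOperads

/-! ### Linear species and operads -/

/-- A linear species: a functor from finite sets and bijections to `K`-vector spaces. -/
structure LinearSpecies (K : Type v) [Field K] where
  obj : (V : Type u) → [Finite V] → Type w
  [addCommGroup : ∀ (V : Type u) [Finite V], AddCommGroup (obj V)]
  [module : ∀ (V : Type u) [Finite V], Module K (obj V)]
  map : ∀ {V W : Type u} [Finite V] [Finite W], (V ≃ W) → (obj V →ₗ[K] obj W)
  map_refl : ∀ (V : Type u) [Finite V] (x : obj V), map (Equiv.refl V) x = x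
  map_trans : ∀ {V W X : Type u} [Finite V] [Finite W] [Finite X] (σ : V ≃ W) (τ : W ≃ X)
    (x : obj V), map (σ.trans τ) x = map τ (map σ x)

attribute [instance] LinearSpecies.addCommGroup LinearSpecies.module

/-- The data of an operad: a linear species, a unit and a partial composition.
`Option A` is `A ⊔ {∗}`, so that `obj (Option A)` is the derivative of the species at `A`, and
`comp x y` is `x ∘_∗ y` on the disjoint union `A ⊔ B`.
A natural map from the singleton species is the same as one element over a point. -/
structure OperadData (K : Type v) [Field K] extends LinearSpecies.{u, v, w} K where
  one : obj PUnit.{u + 1}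
  comp : ∀ {A B : Type u} [Finite A] [Finite B],
    obj (Option A) →ₗ[K] obj B →ₗ[K] obj (A ⊕ B)

/-- `(A ⊔ {∗}) ⊔ B = (A ⊔ B) ⊔ {∗}`. -/
def starLeft (A B : Type u) : Option A ⊕ B ≃ Option (A ⊕ B) where
  toFun
    | Sum.inl none => none
    | Sum.inl (some a) => some (Sum.inl a)
    | Sum.inr b => some (Sum.inr b)
  invFun
    | none => Sum.inl none
    | some (Sum.inl a) => Sum.inl (some a)
    | some (Sum.inr b) => Sum.inr b
  left_inv := by rintro ((_ | a) | b) <;> rfl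
  right_inv := by rintro (_ | (a | b)) <;> rfl

/-- `A ⊔ (B ⊔ {∗}) = (A ⊔ B) ⊔ {∗}`. -/
def starRight (A B : Type u) : A ⊕ Option B ≃ Option (A ⊕ B) where
  toFun
    | Sum.inl a => some (Sum.inl a)
    | Sum.inr none => none
    | Sum.inr (some b) => some (Sum.inr b)
  invFun
    | none => Sum.inr none
    | some (Sum.inl a) => Sum.inl a
    | some (Sum.inr b) => Sum.inr (some b)
  left_inv := by rintro (a | (_ | b)) <;> rfl
  right_inv := by rintro (_ | (a | b)) <;> rfl

/-- Exchange of the two added points of `(A ⊔ {∗₂}) ⊔ {∗₁}`. -/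
def starSwap (A : Type u) : Option (Option A) ≃ Option (Option A) where
  toFun
    | none => some none
    | some none => none
    | some (some a) => some (some a)
  invFun
    | none => some none
    | some none => none
    | some (some a) => some (some a)
  left_inv := by rintro (_ | (_ | a)) <;> rfl
  right_inv := by rintro (_ | (_ | a)) <;> rfl

/-- `(A ⊔ C) ⊔ B = (A ⊔ B) ⊔ C`. -/
def sumExchange (A B C : Type u) : (A ⊕ C) ⊕ B ≃ (A ⊕ B) ⊕ C :=
  (Equiv.sumAssoc A C B).trans
    (((Equiv.refl A).sumCongr (Equiv.sumComm C B)).trans (Equiv.sumAssoc A B C).symm)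

namespace OperadData

variable {K : Type v} [Field K]

/-- The laws of a (positive, symmetric, linear) operad. -/
structure IsOperad (P : OperadData.{u, v, w} K) : Prop where
  positive : ∀ (V : Type u) [Finite V] [IsEmpty V], Subsingleton (P.obj V)
  comp_natural : ∀ {A A' B B' : Type u} [Finite A] [Finite A'] [Finite B] [Finite B']
    (σ : A ≃ A') (τ : B ≃ B') (x : P.obj (Option A)) (y : P.obj B),
    P.comp (P.map σ.optionCongr x) (P.map τ y) = P.map (σ.sumCongr τ) (P.comp x y)
  /-- parallel composition: `(x ∘_{∗₁} y) ∘_{∗₂} z = (x ∘_{∗₂} z) ∘_{∗₁} y` -/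
  comp_parallel : ∀ {A B C : Type u} [Finite A] [Finite B] [Finite C]
    (x : P.obj (Option (Option A))) (y : P.obj B) (z : P.obj C),
    P.comp (P.map (starLeft A B) (P.comp x y)) z =
      P.map (sumExchange A B C)
        (P.comp (P.map (starLeft A C) (P.comp (P.map (starSwap A) x) z)) y)
  /-- sequential composition: `(x ∘_{∗₁} y) ∘_{∗₂} z = x ∘_{∗₁} (y ∘_{∗₂} z)` -/
  comp_assoc : ∀ {A B C : Type u} [Finite A] [Finite B] [Finite C]
    (x : P.obj (Option A)) (y : P.obj (Option B)) (z : P.obj C),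
    P.comp (P.map (starRight A B) (P.comp x y)) z =
      P.map (Equiv.sumAssoc A B C).symm (P.comp x (P.comp y z))
  comp_one : ∀ {A : Type u} [Finite A] (x : P.obj (Option A)),
    P.comp x P.one = P.map (Equiv.optionEquivSumPUnit.{u, u} A) x
  one_comp : ∀ {B : Type u} [Finite B] (y : P.obj B),
    P.map (Equiv.emptySum PEmpty.{u + 1} B)
      (P.comp (P.map (Equiv.ofUnique PUnit.{u + 1} (Option PEmpty.{u + 1})) P.one) y) = y

/-- A morphism of operads. -/
structure Hom (P : OperadData.{u, v, w} K) (Q : OperadData.{u, v, w'} K) where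
  app : ∀ (V : Type u) [Finite V], P.obj V →ₗ[K] Q.obj V
  natural : ∀ {V W : Type u} [Finite V] [Finite W] (σ : V ≃ W) (x : P.obj V),
    app W (P.map σ x) = Q.map σ (app V x)
  map_one : app PUnit.{u + 1} P.one = Q.one
  map_comp : ∀ {A B : Type u} [Finite A] [Finite B] (x : P.obj (Option A)) (y : P.obj B),
    app (A ⊕ B) (P.comp x y) = Q.comp (app (Option A) x) (app B y)

/-- Monomorphisms of operads. -/
def Hom.IsMono {P : OperadData.{u, v, w} K} {Q : OperadData.{u, v, w'} K} (f : Hom P Q) : Prop :=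
  ∀ (V : Type u) [Finite V], Function.Injective (f.app V)

/-- Isomorphisms of operads (the inverse is then again a morphism). -/
def Hom.IsIso {P : OperadData.{u, v, w} K} {Q : OperadData.{u, v, w'} K} (f : Hom P Q) : Prop :=
  ∀ (V : Type u) [Finite V], Function.Bijective (f.app V)

/-- A family of subspaces of a species. -/
abbrev Family (P : OperadData.{u, v, w} K) : Type (max (u + 1) w) :=
  ∀ (V : Type u) [Finite V], Submodule K (P.obj V)

/-- The family of subspaces `F` is a suboperad. -/
structure IsSuboperad (P : OperadData.{u, v, w} K) (F : Family P) : Prop where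
  map_mem : ∀ {V W : Type u} [Finite V] [Finite W] (σ : V ≃ W) (x : P.obj V),
    x ∈ F V → P.map σ x ∈ F W
  one_mem : P.one ∈ F PUnit.{u + 1}
  comp_mem : ∀ {A B : Type u} [Finite A] [Finite B] (x : P.obj (Option A)) (y : P.obj B),
    x ∈ F (Option A) → y ∈ F B → P.comp x y ∈ F (A ⊕ B)

/-- The family of subspaces `I` is an ideal. -/
structure IsIdeal (P : OperadData.{u, v, w} K) (I : Family P) : Prop where
  map_mem : ∀ {V W : Type u} [Finite V] [Finite W] (σ : V ≃ W) (x : P.obj V),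
    x ∈ I V → P.map σ x ∈ I W
  comp_mem_left : ∀ {A B : Type u} [Finite A] [Finite B] (x : P.obj (Option A)) (y : P.obj B),
    x ∈ I (Option A) → P.comp x y ∈ I (A ⊕ B)
  comp_mem_right : ∀ {A B : Type u} [Finite A] [Finite B] (x : P.obj (Option A)) (y : P.obj B),
    y ∈ I B → P.comp x y ∈ I (A ⊕ B)

/-- The suboperad carried by `F`, with the restricted structure. -/
def sub (P : OperadData.{u, v, w} K) (F : Family P) (h : P.IsSuboperad F) :
    OperadData.{u, v, w} K where
  obj V _ := F V
  map {V W} _ _ σ := (P.map σ).restrict (fun x hx => h.map_mem σ x hx)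
  map_refl V _ x := Subtype.ext (P.map_refl V x.1)
  map_trans σ τ x := Subtype.ext (P.map_trans σ τ x.1)
  one := ⟨P.one, h.one_mem⟩
  comp {A B} _ _ := LinearMap.mk₂ K
    (fun (x : F (Option A)) (y : F B) => (⟨P.comp x.1 y.1, h.comp_mem _ _ x.2 y.2⟩ : F (A ⊕ B)))
    (fun _ _ _ => Subtype.ext (by simp))
    (fun _ _ _ => Subtype.ext (by simp))
    (fun _ _ _ => Subtype.ext (by simp))
    (fun _ _ _ => Subtype.ext (by simp))

/-- The quotient operad by an ideal, with the induced structure. -/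
def quot (P : OperadData.{u, v, w} K) (I : Family P) (h : P.IsIdeal I) :
    OperadData.{u, v, w} K where
  obj V _ := P.obj V ⧸ I V
  map {V W} _ _ σ := (I V).mapQ (I W) (P.map σ) (fun x hx => h.map_mem σ x hx)
  map_refl V _ x := by
    obtain ⟨x, rfl⟩ := Submodule.Quotient.mk_surjective _ x
    simp [P.map_refl]
  map_trans σ τ x := by
    obtain ⟨x, rfl⟩ := Submodule.Quotient.mk_surjective _ x
    simp [P.map_trans]
  one := Submodule.Quotient.mk P.one
  comp {A B} _ _ :=
    (I (Option A)).liftQ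
      (LinearMap.mk₂ K
        (fun (x : P.obj (Option A)) (y : P.obj B ⧸ I B) =>
          (I B).mapQ (I (A ⊕ B)) (P.comp x) (fun y hy => h.comp_mem_right x y hy) y)
        (fun x x' y => by
          obtain ⟨y, rfl⟩ := Submodule.Quotient.mk_surjective _ y
          simp)
        (fun c x y => by
          obtain ⟨y, rfl⟩ := Submodule.Quotient.mk_surjective _ y
          simp)
        (fun x y y' => map_add _ y y')
        (fun c x y => map_smul _ c y))
      (fun x hx => by
        rw [LinearMap.mem_ker]
        ext y
        simpa using h.comp_mem_left x y hx)

/-- For families `I`, `F` of subspaces of `P`, the family `I ∩ F` seen inside the suboperad `F`. -/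
def familyIn (P : OperadData.{u, v, w} K) (I F : Family P) (h : P.IsSuboperad F) :
    Family (P.sub F h) :=
  fun V _ => (I V).comap (F V).subtype

end OperadData

/-! ### Multigraphs -/

/-- A multigraph on `V` is a multiset of unordered pairs of vertices. -/
abbrev Multigraph (V : Type u) : Type u := Multiset (Sym2 V)

namespace Multigraph

variable {V : Type u}

/-- Adjacency of distinct vertices in a multigraph. -/
def toSimple (g : Multigraph V) : SimpleGraph V := SimpleGraph.fromEdgeSet {e | e ∈ g}

/-- Connectedness; the vertex set has to be nonempty, as species are positive. -/
def Connected (g : Multigraph V) : Prop := g.toSimple.Connected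

/-- A graph is a multigraph without repeated edges and without loops. -/
def IsGraph (g : Multigraph V) : Prop := g.Nodup ∧ ∀ e ∈ g, ¬ e.IsDiag

/-- A tree is a graph which is connected and without cycles. -/
def IsTree (g : Multigraph V) : Prop := g.IsGraph ∧ g.toSimple.IsTree

/-- `t` is a spanning tree of `g`. -/
def IsSpanningTree (t g : Multigraph V) : Prop := t.IsTree ∧ t ≤ g

end Multigraph

/-- All elements of a finite type. -/
def allOf (B : Type u) [Finite B] : Multiset B :=
  (@Finset.univ B (Fintype.ofFinite B)).val

/-- The ways (with multiplicity) to reconnect an edge, when each end `a` has `ends a` as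
possible new values. -/
def reconnect {H : Type u} {H' : Type w} (ends : H → Multiset H') (e : Sym2 H) :
    Multiset (Sym2 H') :=
  Sym2.lift ⟨fun a b => (ends a).bind fun x => (ends b).map fun y => s(x, y), fun a b => by
    beta_reduce
    rw [Multiset.bind_map_comm]
    exact Multiset.bind_congr fun _ _ => Multiset.map_congr rfl fun _ _ => Sym2.eq_swap⟩ e

/-- The ways (with multiplicity) to reconnect all edges of a multigraph independently. -/
def reconnections {H : Type u} {H' : Type w} (ends : H → Multiset H') (g : Multiset (Sym2 H)) :
    Multiset (Multiset (Sym2 H')) :=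
  (g.map (reconnect ends)).Sections

/-- The sum in `K X` of a multiset of elements of `X`. -/
def formalSum (K : Type v) [Field K] {X : Type u} (s : Multiset X) : X →₀ K :=
  (s.map fun x => Finsupp.single x 1).sum

/-- The multiset of all multigraphs obtained by insertion of `g₂` at the vertex `∗` of `g₁`: an end at
`∗` is connected to any vertex of `g₂`. -/
def insertion {A B : Type u} [Finite B] (g₁ : Multigraph (Option A)) (g₂ : Multigraph B) :
    Multiset (Multigraph (A ⊕ B)) :=
  (reconnections
    (fun a : Option A => match a with
      | some a => {Sum.inl a}
      | none => (allOf B).map Sum.inr) g₁).map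
    fun h => h + g₂.map (Sym2.map Sum.inr)

/-- The species of all multigraphs with the insertion; the positive operads considered below are
suboperads of it, supported on connected multigraphs. -/
def multigraphs (K : Type v) [Field K] : OperadData.{u, v, max u v} K where
  obj V _ := Multigraph V →₀ K
  map σ := Finsupp.lmapDomain K K (Multiset.map (Sym2.map σ))
  map_refl V _ x := by
    have h : (Multiset.map (id : Sym2 V → Sym2 V)) = id := funext Multiset.map_id
    simp [h]
  map_trans σ τ x := by
    simp [← Finsupp.mapDomain_comp, Function.comp_def, Sym2.map_map]
  one := Finsupp.single 0 1
  comp {A B} _ _ := Finsupp.linearCombination K fun g₁ =>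
    Finsupp.linearCombination K fun g₂ => formalSum K (insertion g₁ g₂)

section

variable (K : Type v) [Field K]

/-- `K MG_c`: connected multigraphs. -/
def MGc : (multigraphs.{u, v} K).Family :=
  fun V _ => Finsupp.supported K K {g : Multigraph V | g.Connected}

/-- `K G_c`: connected graphs. -/
def Gc : (multigraphs.{u, v} K).Family :=
  fun V _ => Finsupp.supported K K {g : Multigraph V | g.IsGraph ∧ g.Connected}

/-- `K T`: trees. -/
def T : (multigraphs.{u, v} K).Family :=
  fun V _ => Finsupp.supported K K {g : Multigraph V | g.IsTree}

theorem Gc_le_MGc (V : Type u) [Finite V] : Gc.{u, v} K V ≤ MGc.{u, v} K V :=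
  Finsupp.supported_mono fun _ h => h.2

theorem T_le_MGc (V : Type u) [Finite V] : T.{u, v} K V ≤ MGc.{u, v} K V :=
  Finsupp.supported_mono fun _ h => h.2.1

end

/-! ### Rooted oriented multigraphs -/

/-- An oriented multigraph: every edge end is a vertex together with a label (`true`) or
without (`false`). -/
abbrev OrientedMultigraph (V : Type u) : Type u := Multiset (Sym2 (V × Bool))

/-- The multigraph underlying an oriented one. -/
def OrientedMultigraph.underlying {V : Type u} (g : OrientedMultigraph V) : Multigraph V :=
  g.map (Sym2.map Prod.fst)

/-- The rooted insertion of `p₂` at the vertex `∗` of `p₁`: an unlabelled end at `∗` is connected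
to the root of `p₂`, a labelled one to any vertex of `p₂`. -/
def rootedInsertion {A B : Type u} [Finite B] (p₁ : OrientedMultigraph (Option A) × Option A)
    (p₂ : OrientedMultigraph B × B) : Multiset (OrientedMultigraph (A ⊕ B) × (A ⊕ B)) :=
  (reconnections
    (fun a : Option A × Bool => match a with
      | (some a, l) => {(Sum.inl a, l)}
      | (none, true) => (allOf B).map fun b => (Sum.inr b, true)
      | (none, false) => {(Sum.inr p₂.2, false)}) p₁.1).map
    fun h => (h + p₂.1.map (Sym2.map (Prod.map Sum.inr id)),
      match p₁.2 with
      | some a => Sum.inl a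
      | none => Sum.inr p₂.2)

/-- The species of rooted oriented multigraphs with the rooted insertion; the subspecies
considered below consist of connected ones. -/
def rootedMultigraphs (K : Type v) [Field K] : OperadData.{u, v, max u v} K where
  obj V _ := (OrientedMultigraph V × V) →₀ K
  map σ := Finsupp.lmapDomain K K (Prod.map (Multiset.map (Sym2.map (Prod.map σ id))) σ)
  map_refl V _ x := by
    have h : (Multiset.map (id : Sym2 (V × Bool) → Sym2 (V × Bool))) = id :=
      funext Multiset.map_id
    simp [h]
  map_trans σ τ x := by
    simp [← Finsupp.mapDomain_comp, Function.comp_def, Sym2.map_map, Prod.map_def]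
  one := Finsupp.single (0, PUnit.unit) 1
  comp {A B} _ _ := Finsupp.linearCombination K fun p₁ =>
    Finsupp.linearCombination K fun p₂ => formalSum K (rootedInsertion p₁ p₂)

open Classical in
/-- The orientation of the tree `t` rooted at `r`: the parent end (the one nearer to `r`) of each
edge is labelled, the child end is not. -/
def orientTree {V : Type u} (t : Multigraph V) (r : V) : OrientedMultigraph V :=
  t.map fun e => Sym2.lift
    ⟨fun a b =>
      s((a, decide (t.toSimple.dist r a < t.toSimple.dist r b)),
        (b, decide (t.toSimple.dist r b < t.toSimple.dist r a))),
      fun _ _ => Sym2.eq_swap⟩ e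

/-- The oriented multigraph with all edge ends labelled. -/
def labelAll {V : Type u} (g : Multigraph V) : OrientedMultigraph V :=
  g.map (Sym2.map fun a => (a, true))

open Classical in
/-- The orientation of `g` by a spanning tree `t` and a root `r`: edges of `t` are oriented as in
the tree rooted at `r`, and both ends of all other edges are labelled. -/
def orient {V : Type u} (g t : Multigraph V) (r : V) : OrientedMultigraph V :=
  orientTree t r + labelAll (g - t)

section

variable (K : Type v) [Field K]

/-- `K G_orc^•`: rooted connected oriented graphs. -/
def Gorc : (rootedMultigraphs.{u, v} K).Family :=
  fun V _ => Finsupp.supported K K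
    {p : OrientedMultigraph V × V | p.1.underlying.IsGraph ∧ p.1.underlying.Connected}

/-- `PLie`: rooted trees, seen as rooted oriented graphs. -/
def PLie : (rootedMultigraphs.{u, v} K).Family :=
  fun V _ => Finsupp.supported K K
    {p : OrientedMultigraph V × V | ∃ t : Multigraph V, t.IsTree ∧ p = (orientTree t p.2, p.2)}

/-- The sum over all roots `r` of `g` oriented by the spanning tree `t r` and the root `r`. -/
def rootSum {V : Type u} [Finite V] (g : Multigraph V) (t : V → Multigraph V) :
    (rootedMultigraphs.{u, v} K).obj V :=
  formalSum K ((allOf V).map fun r => (orient g (t r) r, r))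

/-- `K O₁`. -/
def O1 : (rootedMultigraphs.{u, v} K).Family :=
  fun V _ => Submodule.span K
    {x | ∃ (g : Multigraph V) (t : V → Multigraph V), g.Connected ∧
      (∀ r, (t r).IsSpanningTree g) ∧ x = rootSum K g t}

/-- `K O₂`. -/
def O2 : (rootedMultigraphs.{u, v} K).Family :=
  fun V _ => Submodule.span K
    {x : (OrientedMultigraph V × V) →₀ K | ∃ (g : Multigraph V) (r : V) (t₁ t₂ : Multigraph V),
      g.Connected ∧ t₁.IsSpanningTree g ∧ t₂.IsSpanningTree g ∧
      x = Finsupp.single (orient g t₁ r, r) 1 - Finsupp.single (orient g t₂ r, r) 1}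

/-- `K O₁ ∩ K G_orc^•`. -/
def O1G : (rootedMultigraphs.{u, v} K).Family := fun V _ => O1 K V ⊓ Gorc K V

/-- `K O₂ ∩ K G_orc^•`. -/
def O2G : (rootedMultigraphs.{u, v} K).Family := fun V _ => O2 K V ⊓ Gorc K V

variable {K}

/-- The suboperad `K MG_c` of the graph insertion operad. -/
abbrev opMGc (h : (multigraphs.{u, v} K).IsSuboperad (MGc K)) := (multigraphs K).sub (MGc K) h

/-- The suboperad `K G_c`. -/
abbrev opGc (h : (multigraphs.{u, v} K).IsSuboperad (Gc K)) := (multigraphs K).sub (Gc K) h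

/-- The suboperad `K T`. -/
abbrev opT (h : (multigraphs.{u, v} K).IsSuboperad (T K)) := (multigraphs K).sub (T K) h

/-- The pre-Lie operad. -/
abbrev opPLie (h : (rootedMultigraphs.{u, v} K).IsSuboperad (PLie K)) :=
  (rootedMultigraphs K).sub (PLie K) h

/-- `K O₂` as a family of subspaces of `K O₁`. -/
abbrev O2inO1 (h : (rootedMultigraphs.{u, v} K).IsSuboperad (O1 K)) :=
  (rootedMultigraphs K).familyIn (O2 K) (O1 K) h

/-- `K O₂ ∩ K G_orc^•` as a family of subspaces of `K O₁ ∩ K G_orc^•`. -/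
abbrev O2GinO1G (h : (rootedMultigraphs.{u, v} K).IsSuboperad (O1G K)) :=
  (rootedMultigraphs K).familyIn (O2G K) (O1G K) h

/-- The operad `K O₁ / K O₂`. -/
abbrev opQ (h₁ : (rootedMultigraphs.{u, v} K).IsSuboperad (O1 K))
    (h₂ : ((rootedMultigraphs.{u, v} K).sub (O1 K) h₁).IsIdeal (O2inO1 h₁)) :=
  ((rootedMultigraphs K).sub (O1 K) h₁).quot (O2inO1 h₁) h₂

/-- The operad `(K O₁ ∩ K G_orc^•) / (K O₂ ∩ K G_orc^•)`. -/
abbrev opQG (h₁ : (rootedMultigraphs.{u, v} K).IsSuboperad (O1G K))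
    (h₂ : ((rootedMultigraphs.{u, v} K).sub (O1G K) h₁).IsIdeal (O2GinO1G h₁)) :=
  ((rootedMultigraphs K).sub (O1G K) h₁).quot (O2GinO1G h₁) h₂

variable (K)

/-- A connected multigraph as an element of `K MG_c`. -/
def MGc.of {V : Type u} [Finite V] (g : Multigraph V) (hg : g.Connected) : MGc.{u, v} K V :=
  ⟨Finsupp.single g 1, Finsupp.single_mem_supported K 1 hg⟩

/-- A tree as an element of `K T`. -/
def T.of {V : Type u} [Finite V] (t : Multigraph V) (ht : t.IsTree) : T.{u, v} K V :=
  ⟨Finsupp.single t 1, Finsupp.single_mem_supported K 1 ht⟩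

/-- The elements of `O₁`, as elements of `K O₁`. -/
def O1.of {V : Type u} [Finite V] (g : Multigraph V) (hg : g.Connected) (t : V → Multigraph V)
    (ht : ∀ r, (t r).IsSpanningTree g) : O1.{u, v} K V :=
  ⟨rootSum K g t, Submodule.subset_span ⟨g, t, hg, ht, rfl⟩⟩

/-- The natural map `(K O₁ ∩ K G_orc^•) / (K O₂ ∩ K G_orc^•) → K O₁ / K O₂`. -/
def quotInclusion (V : Type u) [Finite V] :
    (O1G.{u, v} K V ⧸ (O2G.{u, v} K V).comap (O1G.{u, v} K V).subtype) →ₗ[K]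
      (O1.{u, v} K V ⧸ (O2.{u, v} K V).comap (O1.{u, v} K V).subtype) :=
  Submodule.mapQ _ _ (Submodule.inclusion (inf_le_left : O1G K V ≤ O1 K V))
    (fun x hx => (hx : x.1 ∈ O2G K V).1)

end

end GraphOperads

end

/-!
The idea is to compare everything with multigraphs through the linear map `average`, which forgets
the orientation and the root of a rooted oriented multigraph and divides by the number of vertices.

Call a rooted oriented multigraph tree-oriented (`IsTreeOriented`) if it is `orient g t r` for some
spanning tree `t` of `g`. Equivalently, there is a parent function `par` on the vertices, leading
to the root `r` from everywhere, such that every vertex `v ≠ r` carries exactly one unlabelled end,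
that of the edge from `par v` to `v`, and all other ends are labelled. In this description it is
plain that the rooted insertion preserves tree-oriented multigraphs
(`IsTreeOriented.rootedInsertion`): the unlabelled end at `∗`, if any, goes to the root of the
inserted multigraph, which thereby gets its parent, and the other edges of the outer tree keep
their child while the parent end may go anywhere. Choosing `∗` as the root one sees that insertion
preserves connectedness, and counting edges that it preserves trees.

Let `forget` replace an oriented multigraph by the underlying one but keep the root, and let
`sumRoots g = ∑ r, (g, r)`. Then `K O₂` is the kernel of `forget` on the span of the tree-oriented
multigraphs (`mem_O2_iff`), and `K O₁` is the preimage there of `sumRoots (K MG_c)` (`mem_O1_iff`).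
If `x` and `y` are sums over all roots over `g₁` and `g₂`, then `forget (x ∘ y)` is
`sumRoots (g₁ ∘ g₂)`: for a root other than `∗` exactly one end at `∗` is unlabelled, and as the
root of `y` runs through all vertices so does the new position of this end
(`sum_roots_rootedInsertion`). Hence `K O₁` is a suboperad on which `average` is a morphism of
operads, onto `K MG_c` and with kernel `K O₂`; the isomorphism `ψ` is the inverse of the induced map
(`exists_hom_of_average`). Restricting to graphs gives the third part. Finally `forget` is injective
on `PLie`, so that the identities needed for `t ↦ ∑ r, (t_r, r)` may be checked after applying it.

The operad laws hold for all multigraphs, connected or not, and follow from the rules for iterated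
reconnections of edge ends (`reconnections_bind_add`).
-/

noncomputable section

namespace GraphOperads

/-! ### Suboperads and quotients -/

namespace OperadData

variable {K : Type v} [Field K]

/-- The laws of an operad, without positivity. -/
structure Laws (P : OperadData.{u, v, w} K) : Prop where
  comp_natural : ∀ {A A' B B' : Type u} [Finite A] [Finite A'] [Finite B] [Finite B']
    (σ : A ≃ A') (τ : B ≃ B') (x : P.obj (Option A)) (y : P.obj B),
    P.comp (P.map σ.optionCongr x) (P.map τ y) = P.map (σ.sumCongr τ) (P.comp x y)
  comp_parallel : ∀ {A B C : Type u} [Finite A] [Finite B] [Finite C]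
    (x : P.obj (Option (Option A))) (y : P.obj B) (z : P.obj C),
    P.comp (P.map (starLeft A B) (P.comp x y)) z =
      P.map (sumExchange A B C)
        (P.comp (P.map (starLeft A C) (P.comp (P.map (starSwap A) x) z)) y)
  comp_assoc : ∀ {A B C : Type u} [Finite A] [Finite B] [Finite C]
    (x : P.obj (Option A)) (y : P.obj (Option B)) (z : P.obj C),
    P.comp (P.map (starRight A B) (P.comp x y)) z =
      P.map (Equiv.sumAssoc A B C).symm (P.comp x (P.comp y z))
  comp_one : ∀ {A : Type u} [Finite A] (x : P.obj (Option A)),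
    P.comp x P.one = P.map (Equiv.optionEquivSumPUnit.{u, u} A) x
  one_comp : ∀ {B : Type u} [Finite B] (y : P.obj B),
    P.map (Equiv.emptySum PEmpty.{u + 1} B)
      (P.comp (P.map (Equiv.ofUnique PUnit.{u + 1} (Option PEmpty.{u + 1})) P.one) y) = y

theorem Laws.isOperad {P : OperadData.{u, v, w} K} (h : P.Laws)
    (hp : ∀ (V : Type u) [Finite V] [IsEmpty V], Subsingleton (P.obj V)) : P.IsOperad :=
  ⟨hp, h.comp_natural, h.comp_parallel, h.comp_assoc, h.comp_one, h.one_comp⟩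

/-- The laws of an operad may be checked on spanning families `b`. -/
theorem Laws.of_span {P : OperadData.{u, v, w} K} {ι : Type u → Type w'}
    (b : ∀ (V : Type u) [Finite V], ι V → P.obj V)
    (ind : ∀ (V : Type u) [Finite V] {p : P.obj V → Prop} (x : P.obj V), p 0 →
      (∀ x y, p x → p y → p (x + y)) → (∀ (c : K) x, p x → p (c • x)) → (∀ i, p (b V i)) → p x)
    (comp_natural : ∀ {A A' B B' : Type u} [Finite A] [Finite A'] [Finite B] [Finite B']
      (σ : A ≃ A') (τ : B ≃ B') (i : ι (Option A)) (j : ι B),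
      P.comp (P.map σ.optionCongr (b _ i)) (P.map τ (b _ j)) =
        P.map (σ.sumCongr τ) (P.comp (b _ i) (b _ j)))
    (comp_parallel : ∀ {A B C : Type u} [Finite A] [Finite B] [Finite C]
      (i : ι (Option (Option A))) (j : ι B) (k : ι C),
      P.comp (P.map (starLeft A B) (P.comp (b _ i) (b _ j))) (b _ k) =
        P.map (sumExchange A B C)
          (P.comp (P.map (starLeft A C) (P.comp (P.map (starSwap A) (b _ i)) (b _ k))) (b _ j)))
    (comp_assoc : ∀ {A B C : Type u} [Finite A] [Finite B] [Finite C]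
      (i : ι (Option A)) (j : ι (Option B)) (k : ι C),
      P.comp (P.map (starRight A B) (P.comp (b _ i) (b _ j))) (b _ k) =
        P.map (Equiv.sumAssoc A B C).symm (P.comp (b _ i) (P.comp (b _ j) (b _ k))))
    (comp_one : ∀ {A : Type u} [Finite A] (i : ι (Option A)),
      P.comp (b _ i) P.one = P.map (Equiv.optionEquivSumPUnit.{u, u} A) (b _ i))
    (one_comp : ∀ {B : Type u} [Finite B] (j : ι B),
      P.map (Equiv.emptySum PEmpty.{u + 1} B)
        (P.comp (P.map (Equiv.ofUnique PUnit.{u + 1} (Option PEmpty.{u + 1})) P.one) (b _ j)) =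
          b _ j) : P.Laws where
  comp_natural {A A' B B'} _ _ _ _ σ τ x y := by
    refine ind _ (p := fun x => P.comp (P.map σ.optionCongr x) (P.map τ y) =
      P.map (σ.sumCongr τ) (P.comp x y)) x (by simp) (fun x x' hx hx' => by simp [hx, hx'])
      (fun c x hx => by simp [hx]) fun i => ?_
    exact ind _ (p := fun y => P.comp (P.map σ.optionCongr (b _ i)) (P.map τ y) =
      P.map (σ.sumCongr τ) (P.comp (b _ i) y)) y (by simp) (fun x x' hx hx' => by simp [hx, hx'])
      (fun c x hx => by simp [hx]) fun j => comp_natural σ τ i j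
  comp_parallel {A B C} _ _ _ x y z := by
    refine ind _ (p := fun x => P.comp (P.map (starLeft A B) (P.comp x y)) z =
      P.map (sumExchange A B C)
        (P.comp (P.map (starLeft A C) (P.comp (P.map (starSwap A) x) z)) y)) x
      (by simp) (fun x x' hx hx' => by simp [hx, hx']) (fun c x hx => by simp [hx]) fun i => ?_
    refine ind _ (p := fun y => P.comp (P.map (starLeft A B) (P.comp (b _ i) y)) z =
      P.map (sumExchange A B C)
        (P.comp (P.map (starLeft A C) (P.comp (P.map (starSwap A) (b _ i)) z)) y)) y
      (by simp) (fun x x' hx hx' => by simp [hx, hx']) (fun c x hx => by simp [hx]) fun j => ?_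
    exact ind _ (p := fun z => P.comp (P.map (starLeft A B) (P.comp (b _ i) (b _ j))) z =
      P.map (sumExchange A B C)
        (P.comp (P.map (starLeft A C) (P.comp (P.map (starSwap A) (b _ i)) z)) (b _ j))) z
      (by simp) (fun x x' hx hx' => by simp [hx, hx']) (fun c x hx => by simp [hx])
      fun k => comp_parallel i j k
  comp_assoc {A B C} _ _ _ x y z := by
    refine ind _ (p := fun x => P.comp (P.map (starRight A B) (P.comp x y)) z =
      P.map (Equiv.sumAssoc A B C).symm (P.comp x (P.comp y z))) x
      (by simp) (fun x x' hx hx' => by simp [hx, hx']) (fun c x hx => by simp [hx]) fun i => ?_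
    refine ind _ (p := fun y => P.comp (P.map (starRight A B) (P.comp (b _ i) y)) z =
      P.map (Equiv.sumAssoc A B C).symm (P.comp (b _ i) (P.comp y z))) y
      (by simp) (fun x x' hx hx' => by simp [hx, hx']) (fun c x hx => by simp [hx]) fun j => ?_
    exact ind _ (p := fun z => P.comp (P.map (starRight A B) (P.comp (b _ i) (b _ j))) z =
      P.map (Equiv.sumAssoc A B C).symm (P.comp (b _ i) (P.comp (b _ j) z))) z
      (by simp) (fun x x' hx hx' => by simp [hx, hx']) (fun c x hx => by simp [hx])
      fun k => comp_assoc i j k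
  comp_one {A} _ x :=
    ind _ (p := fun x => P.comp x P.one = P.map (Equiv.optionEquivSumPUnit.{u, u} A) x) x
      (by simp) (fun x x' hx hx' => by simp [hx, hx']) (fun c x hx => by simp [hx])
      fun i => comp_one i
  one_comp {B} _ y :=
    ind _ (p := fun y => P.map (Equiv.emptySum PEmpty.{u + 1} B)
        (P.comp (P.map (Equiv.ofUnique PUnit.{u + 1} (Option PEmpty.{u + 1})) P.one) y) = y) y
      (by simp) (fun x x' hx hx' => by simp [hx, hx']) (fun c x hx => by simp [hx])
      fun j => one_comp j

theorem Laws.sub {P : OperadData.{u, v, w} K} (h : P.Laws) (F : Family P)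
    (hF : P.IsSuboperad F) : (P.sub F hF).Laws where
  comp_natural σ τ x y := Subtype.ext (h.comp_natural σ τ x.1 y.1)
  comp_parallel x y z := Subtype.ext (h.comp_parallel x.1 y.1 z.1)
  comp_assoc x y z := Subtype.ext (h.comp_assoc x.1 y.1 z.1)
  comp_one x := Subtype.ext (h.comp_one x.1)
  one_comp y := Subtype.ext (h.one_comp y.1)

theorem Laws.quot {P : OperadData.{u, v, w} K} (h : P.Laws) (I : Family P)
    (hI : P.IsIdeal I) : (P.quot I hI).Laws where
  comp_natural {A A' B B'} _ _ _ _ σ τ x y := by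
    obtain ⟨x, rfl⟩ := Submodule.Quotient.mk_surjective _ x
    obtain ⟨y, rfl⟩ := Submodule.Quotient.mk_surjective _ y
    exact congrArg (Submodule.Quotient.mk (p := I (A' ⊕ B'))) (h.comp_natural σ τ x y)
  comp_parallel {A B C} _ _ _ x y z := by
    obtain ⟨x, rfl⟩ := Submodule.Quotient.mk_surjective _ x
    obtain ⟨y, rfl⟩ := Submodule.Quotient.mk_surjective _ y
    obtain ⟨z, rfl⟩ := Submodule.Quotient.mk_surjective _ z
    exact congrArg (Submodule.Quotient.mk (p := I ((A ⊕ B) ⊕ C))) (h.comp_parallel x y z)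
  comp_assoc {A B C} _ _ _ x y z := by
    obtain ⟨x, rfl⟩ := Submodule.Quotient.mk_surjective _ x
    obtain ⟨y, rfl⟩ := Submodule.Quotient.mk_surjective _ y
    obtain ⟨z, rfl⟩ := Submodule.Quotient.mk_surjective _ z
    exact congrArg (Submodule.Quotient.mk (p := I ((A ⊕ B) ⊕ C))) (h.comp_assoc x y z)
  comp_one {A} _ x := by
    obtain ⟨x, rfl⟩ := Submodule.Quotient.mk_surjective _ x
    exact congrArg (Submodule.Quotient.mk (p := I (A ⊕ PUnit.{u + 1}))) (h.comp_one x)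
  one_comp {B} _ y := by
    obtain ⟨y, rfl⟩ := Submodule.Quotient.mk_surjective _ y
    exact congrArg (Submodule.Quotient.mk (p := I B)) (h.one_comp y)

theorem isSuboperad_span {P : OperadData.{u, v, w} K}
    (S : ∀ (V : Type u) [Finite V], Set (P.obj V))
    (map : ∀ {V W : Type u} [Finite V] [Finite W] (σ : V ≃ W), ∀ x ∈ S V, P.map σ x ∈ S W)
    (one : P.one ∈ S PUnit.{u + 1})
    (comp : ∀ {A B : Type u} [Finite A] [Finite B], ∀ x ∈ S (Option A), ∀ y ∈ S B,
      P.comp x y ∈ Submodule.span K (S (A ⊕ B))) :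
    P.IsSuboperad fun V _ => Submodule.span K (S V) where
  map_mem {V W} _ _ σ x hx :=
    (Submodule.span_le (p := (Submodule.span K (S W)).comap (P.map σ))).2
      (fun x hx => Submodule.subset_span (map σ x hx)) hx
  one_mem := Submodule.subset_span one
  comp_mem {A B} _ _ x y hx hy := by
    induction hx, hy using Submodule.span_induction₂ with
    | zero_left y hy => simp
    | zero_right y hy => simp
    | add_left x y z _ _ _ hx hy => simpa using add_mem hx hy
    | add_right x y z _ _ _ hx hy => simpa using add_mem hx hy
    | smul_left c x y _ _ hx => simpa using Submodule.smul_mem _ c hx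
    | smul_right c x y _ _ hx => simpa using Submodule.smul_mem _ c hx
    | mem_mem x y hx hy => exact comp x hx y hy

end OperadData

/-! ### Calculus of reconnections -/

section Reconnections

variable {H : Type*} {H' : Type*} {H'' : Type*}

theorem reconnect_mk (e : H → Multiset H') (a b : H) :
    reconnect e s(a, b) = (e a).bind fun x => (e b).map fun y => s(x, y) := rfl

theorem mem_reconnect_mk {e : H → Multiset H'} {a b : H} {z : Sym2 H'} :
    z ∈ reconnect e s(a, b) ↔ ∃ x ∈ e a, ∃ y ∈ e b, s(x, y) = z := by
  simp [reconnect_mk]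

theorem reconnect_map (e : H' → Multiset H'') (f : H → H') (z : Sym2 H) :
    reconnect e (z.map f) = reconnect (fun h => e (f h)) z := by
  induction z with | _ a b => rfl

theorem map_reconnect (e : H → Multiset H') (f : H' → H'') (z : Sym2 H) :
    (reconnect e z).map (Sym2.map f) = reconnect (fun h => (e h).map f) z := by
  induction z with | _ a b =>
  simp [reconnect_mk, Multiset.map_bind, Multiset.bind_map, Function.comp_def]

theorem reconnect_singleton (f : H → H') (z : Sym2 H) :
    reconnect (fun h => {f h}) z = {z.map f} := by
  induction z with | _ a b => simp [reconnect_mk]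

theorem reconnect_bind (e : H → Multiset H') (e' : H' → Multiset H'') (z : Sym2 H) :
    (reconnect e z).bind (reconnect e') = reconnect (fun h => (e h).bind e') z := by
  induction z with | _ a b =>
  simp only [reconnect_mk, Multiset.bind_assoc, Multiset.bind_map, Multiset.map_bind]
  refine Multiset.bind_congr fun x _ => ?_
  rw [Multiset.bind_bind]

theorem reconnect_congr {e e' : H → Multiset H'} {z : Sym2 H} (h : ∀ a ∈ z, e a = e' a) :
    reconnect e z = reconnect e' z := by
  induction z with | _ a b =>
  simp [reconnect_mk, h a (by simp), h b (by simp)]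

theorem reconnections_zero (e : H → Multiset H') : reconnections e 0 = {0} := by
  simp [reconnections]

theorem reconnections_cons (e : H → Multiset H') (z : Sym2 H) (g : Multiset (Sym2 H)) :
    reconnections e (z ::ₘ g) =
      (reconnect e z).bind fun a => (reconnections e g).map (a ::ₘ ·) := by
  simp [reconnections]

theorem reconnections_add (e : H → Multiset H') (g h : Multiset (Sym2 H)) :
    reconnections e (g + h) =
      (reconnections e g).bind fun a => (reconnections e h).map (a + ·) := by
  simp [reconnections]

theorem reconnections_congr {e e' : H → Multiset H'} {g : Multiset (Sym2 H)}
    (h : ∀ z ∈ g, ∀ a ∈ z, e a = e' a) : reconnections e g = reconnections e' g := by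
  unfold reconnections
  rw [Multiset.map_congr rfl fun z hz => reconnect_congr (h z hz)]

theorem reconnections_map (e : H' → Multiset H'') (f : H → H') (g : Multiset (Sym2 H)) :
    reconnections e (g.map (Sym2.map f)) = reconnections (fun h => e (f h)) g := by
  simp [reconnections, reconnect_map]

theorem map_reconnections (e : H → Multiset H') (f : H' → H'') (g : Multiset (Sym2 H)) :
    (reconnections e g).map (Multiset.map (Sym2.map f)) =
      reconnections (fun h => (e h).map f) g := by
  induction g using Multiset.induction with
  | empty => simp [reconnections_zero]
  | cons z g ih =>
    simp [reconnections_cons, Multiset.map_bind, ← map_reconnect, Multiset.bind_map, ← ih]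

theorem reconnections_singleton (f : H → H') (g : Multiset (Sym2 H)) :
    reconnections (fun h => {f h}) g = {g.map (Sym2.map f)} := by
  induction g using Multiset.induction with
  | empty => simp [reconnections_zero]
  | cons z g ih => simp [reconnections_cons, reconnect_singleton, ih]

theorem reconnections_bind (e : H → Multiset H') (e' : H' → Multiset H'')
    (g : Multiset (Sym2 H)) :
    (reconnections e g).bind (reconnections e') = reconnections (fun h => (e h).bind e') g := by
  induction g using Multiset.induction with
  | empty => simp [reconnections_zero]
  | cons z g ih =>
    simp only [reconnections_cons, Multiset.bind_assoc, Multiset.bind_map, ← reconnect_bind,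
      ← ih, Multiset.map_bind]
    refine Multiset.bind_congr fun x _ => ?_
    rw [Multiset.bind_bind]

/-- A second reconnection, applied after a first one in which a part `y` was added. -/
theorem reconnections_bind_add {L : Type*} (e : H → Multiset H') (i : L → H')
    (e' : H' → Multiset H'') (x : Multiset (Sym2 H)) (y : Multiset (Sym2 L)) :
    ((reconnections e x).bind fun h => reconnections e' (h + y.map (Sym2.map i))) =
      (reconnections (fun a => (e a).bind e') x).bind fun a =>
        (reconnections (fun b => e' (i b)) y).map (a + ·) := by
  simp only [reconnections_add, ← reconnections_bind, Multiset.bind_assoc, reconnections_map]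

theorem mem_reconnections_of_le {e e' : H → Multiset H'} (h : ∀ a, ∀ x ∈ e a, x ∈ e' a)
    {g : Multiset (Sym2 H)} {k : Multiset (Sym2 H')} (hk : k ∈ reconnections e g) :
    k ∈ reconnections e' g := by
  induction g using Multiset.induction generalizing k with
  | empty => simpa [reconnections_zero] using hk
  | cons z g ih =>
    simp only [reconnections_cons, Multiset.mem_bind, Multiset.mem_map] at hk ⊢
    obtain ⟨a, ha, k, hk, rfl⟩ := hk
    refine ⟨a, ?_, k, ih hk, rfl⟩
    induction z with | _ b c =>
    rw [mem_reconnect_mk] at ha ⊢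
    obtain ⟨x, hx, y, hy, rfl⟩ := ha
    exact ⟨x, h _ _ hx, y, h _ _ hy, rfl⟩

/-- A reconnection of the edges `f v`, for `v` in a multiset without repetitions, amounts to a
choice of a reconnection `c v` of each of them. -/
theorem exists_of_mem_reconnections_map {ι : Type*} [Nonempty H'] {e : H → Multiset H'}
    {s : Multiset ι} (hs : s.Nodup) {f : ι → Sym2 H} {k : Multiset (Sym2 H')}
    (hk : k ∈ reconnections e (s.map f)) :
    ∃ c : ι → Sym2 H', (∀ v ∈ s, c v ∈ reconnect e (f v)) ∧ k = s.map c := by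
  classical
  induction s using Multiset.induction generalizing k with
  | empty =>
    have : k = 0 := by simpa [reconnections_zero] using hk
    exact ⟨fun _ => s(Classical.arbitrary _, Classical.arbitrary _), by simp, by simp [this]⟩
  | cons z g ih =>
    simp only [Multiset.map_cons, reconnections_cons, Multiset.mem_bind, Multiset.mem_map] at hk
    obtain ⟨a, ha, k, hk, rfl⟩ := hk
    obtain ⟨hz, hg⟩ := Multiset.nodup_cons.1 hs
    obtain ⟨c, hc, rfl⟩ := ih hg hk
    refine ⟨Function.update c z a, ?_, ?_⟩
    · intro v hv
      rcases eq_or_ne v z with rfl | hvz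
      · simpa using ha
      · simpa [hvz] using hc v (by simpa [hvz] using hv)
    · rw [Multiset.map_cons, Function.update_self]
      congr 1
      refine Multiset.map_congr rfl fun v hv => ?_
      rw [Function.update_of_ne]
      rintro rfl
      exact hz hv

end Reconnections

/-! ### Formal sums -/

section FormalSum

variable {K : Type v} [Field K] {X Y Z : Type*}

@[simp] theorem formalSum_zero : formalSum K (0 : Multiset X) = 0 := by simp [formalSum]

@[simp] theorem formalSum_cons (a : X) (s : Multiset X) :
    formalSum K (a ::ₘ s) = Finsupp.single a 1 + formalSum K s := by simp [formalSum]

@[simp] theorem formalSum_singleton (a : X) :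
    formalSum K ({a} : Multiset X) = Finsupp.single a 1 := by simp [formalSum]

@[simp] theorem formalSum_add (s t : Multiset X) :
    formalSum K (s + t) = formalSum K s + formalSum K t := by simp [formalSum]

theorem formalSum_replicate (n : ℕ) (a : X) :
    formalSum K (Multiset.replicate n a) = (n : K) • Finsupp.single a 1 := by
  induction n with
  | zero => simp
  | succ n ih =>
    rw [Multiset.replicate_succ, formalSum_cons, ih, Nat.cast_add, add_smul, add_comm]
    simp

theorem mapDomain_formalSum (f : X → Y) (s : Multiset X) :
    Finsupp.mapDomain f (formalSum K s) = formalSum K (s.map f) := by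
  induction s using Multiset.induction with
  | empty => simp
  | cons a s ih => simp [Finsupp.mapDomain_add, Finsupp.mapDomain_single, ih]

theorem linearCombination_formalSum (f : X → Multiset Y) (s : Multiset X) :
    Finsupp.linearCombination K (fun x => formalSum K (f x)) (formalSum K s) =
      formalSum K (s.bind f) := by
  induction s using Multiset.induction with
  | empty => simp
  | cons a s ih => simp [ih]

theorem formalSum_mem_supported {s : Multiset X} {S : Set X} (h : ∀ x ∈ s, x ∈ S) :
    formalSum K s ∈ Finsupp.supported K K S := by
  induction s using Multiset.induction with
  | empty => simp
  | cons a s ih =>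
    rw [formalSum_cons]
    exact add_mem (Finsupp.single_mem_supported K 1 (h a (by simp)))
      (ih fun x hx => h x (by simp [hx]))

theorem finsupp_single_induction {p : (X →₀ K) → Prop} (x : X →₀ K) (zero : p 0)
    (add : ∀ x y, p x → p y → p (x + y)) (smul : ∀ (c : K) x, p x → p (c • x))
    (single : ∀ a, p (Finsupp.single a 1)) : p x := by
  induction x using Finsupp.induction_linear with
  | zero => exact zero
  | add x y hx hy => exact add x y hx hy
  | single a c =>
    have := smul c _ (single a)
    rwa [Finsupp.smul_single, smul_eq_mul, mul_one] at this

end FormalSum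

/-! ### The ambient operads -/

theorem allOf_map {A B : Type u} [Finite A] [Finite B] (σ : A ≃ B) :
    (allOf A).map σ = allOf B := by
  let _ := Fintype.ofFinite A
  let _ := Fintype.ofFinite B
  exact Multiset.map_univ_val_equiv σ

@[simp] theorem mem_allOf {A : Type u} [Finite A] (a : A) : a ∈ allOf A :=
  @Finset.mem_univ A (Fintype.ofFinite A) a

theorem nodup_allOf (A : Type u) [Finite A] : (allOf A).Nodup :=
  (@Finset.univ A (Fintype.ofFinite A)).nodup

theorem allOf_option (A : Type u) [Finite A] : allOf (Option A) = none ::ₘ (allOf A).map some := by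
  rw [(nodup_allOf _).ext]
  · rintro (_ | a) <;> simp
  · simp [(nodup_allOf A).map (Option.some_injective A)]

theorem allOf_sum (A B : Type u) [Finite A] [Finite B] :
    allOf (A ⊕ B) = (allOf A).map Sum.inl + (allOf B).map Sum.inr := by
  rw [(nodup_allOf _).ext]
  · rintro (a | b) <;> simp
  · rw [Multiset.nodup_add]
    refine ⟨(nodup_allOf A).map Sum.inl_injective, (nodup_allOf B).map Sum.inr_injective, ?_⟩
    rw [Multiset.disjoint_left]
    simp

theorem allOf_unique (A : Type u) [Unique A] : allOf A = {default} := by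
  rw [(nodup_allOf _).ext (by simp)]
  intro a
  simp [Subsingleton.elim a default]

/-- The possible new values of an end in the insertion of a multigraph on `B`. -/
def insertionEnds (A B : Type u) [Finite B] (a : Option A) : Multiset (A ⊕ B) :=
  match a with
  | some a => {Sum.inl a}
  | none => (allOf B).map Sum.inr

/-- The possible new values of an end in the insertion of a multigraph on `B` rooted at `r`. -/
def rootedEnds (A : Type u) {B : Type u} [Finite B] (r : B) (a : Option A × Bool) :
    Multiset ((A ⊕ B) × Bool) :=
  match a with
  | (some a, l) => {(Sum.inl a, l)}
  | (none, true) => (allOf B).map fun b => (Sum.inr b, true)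
  | (none, false) => {(Sum.inr r, false)}

/-- The new root in an insertion of a multigraph rooted at `r`. -/
def newRoot {A B : Type u} (r : B) (a : Option A) : A ⊕ B :=
  match a with
  | some a => Sum.inl a
  | none => Sum.inr r

section

variable {A B : Type u} [Finite B]

@[simp] theorem insertionEnds_some (a : A) : insertionEnds A B (some a) = {Sum.inl a} := rfl

@[simp] theorem insertionEnds_none : insertionEnds A B none = (allOf B).map Sum.inr := rfl

@[simp] theorem rootedEnds_some (r : B) (a : A) (l : Bool) :
    rootedEnds A r (some a, l) = {(Sum.inl a, l)} := by cases l <;> rfl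

@[simp] theorem rootedEnds_none_true (r : B) :
    rootedEnds A r (none, true) = (allOf B).map fun b => (Sum.inr b, true) := rfl

@[simp] theorem rootedEnds_none_false (r : B) :
    rootedEnds A r (none, false) = {(Sum.inr r, false)} := rfl

omit [Finite B] in
@[simp] theorem newRoot_some (r : B) (a : A) : newRoot r (some a) = Sum.inl a := rfl

omit [Finite B] in
@[simp] theorem newRoot_none (r : B) : newRoot (A := A) r none = Sum.inr r := rfl

theorem insertion_eq (g₁ : Multigraph (Option A)) (g₂ : Multigraph B) :
    insertion g₁ g₂ =
      (reconnections (insertionEnds A B) g₁).map (· + g₂.map (Sym2.map Sum.inr)) := by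
  have : insertionEnds A B = fun a : Option A => match a with
      | some a => {Sum.inl a}
      | none => (allOf B).map Sum.inr := by
    funext a; cases a <;> rfl
  rw [this]; rfl

theorem rootedInsertion_eq (p₁ : OrientedMultigraph (Option A) × Option A)
    (p₂ : OrientedMultigraph B × B) :
    rootedInsertion p₁ p₂ = (reconnections (rootedEnds A p₂.2) p₁.1).map fun h =>
      (h + p₂.1.map (Sym2.map (Prod.map Sum.inr id)), newRoot p₂.2 p₁.2) := by
  have : rootedEnds A p₂.2 = fun a : Option A × Bool => match a with
      | (some a, l) => {(Sum.inl a, l)}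
      | (none, true) => (allOf B).map fun b => (Sum.inr b, true)
      | (none, false) => {(Sum.inr p₂.2, false)} := by
    funext a; rcases a with ⟨_ | a, _ | _⟩ <;> rfl
  rw [this]
  rcases p₁ with ⟨p₁, _ | r⟩ <;> rfl

end

section

variable {K : Type v} [Field K]

theorem multigraphs_induction {V : Type u} [Finite V] {p : (multigraphs.{u, v} K).obj V → Prop}
    (x : (multigraphs.{u, v} K).obj V) (zero : p 0)
    (add : ∀ x y, p x → p y → p (x + y)) (smul : ∀ (c : K) x, p x → p (c • x))
    (single : ∀ g : Multigraph V, p (Finsupp.single g 1)) : p x :=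
  finsupp_single_induction x zero add smul single

theorem rootedMultigraphs_induction {V : Type u} [Finite V]
    {p : (rootedMultigraphs.{u, v} K).obj V → Prop}
    (x : (rootedMultigraphs.{u, v} K).obj V) (zero : p 0)
    (add : ∀ x y, p x → p y → p (x + y)) (smul : ∀ (c : K) x, p x → p (c • x))
    (single : ∀ g : OrientedMultigraph V × V, p (Finsupp.single g 1)) : p x :=
  finsupp_single_induction x zero add smul single

variable {A B : Type u} [Finite A] [Finite B]

theorem multigraphs_comp_formalSum (s : Multiset (Multigraph (Option A)))
    (t : Multiset (Multigraph B)) :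
    (multigraphs.{u, v} K).comp (formalSum K s) (formalSum K t) =
      formalSum K (s.bind fun g₁ => t.bind fun g₂ => insertion g₁ g₂) := by
  change Finsupp.linearCombination K (fun g₁ =>
    Finsupp.linearCombination K fun g₂ => formalSum K (insertion g₁ g₂)) (formalSum K s) _ = _
  induction s using Multiset.induction with
  | empty => simp
  | cons a s ih => simp [ih, linearCombination_formalSum]

theorem multigraphs_comp_single (g₁ : Multigraph (Option A)) (g₂ : Multigraph B) :
    (multigraphs.{u, v} K).comp (Finsupp.single g₁ 1) (Finsupp.single g₂ 1) =
      formalSum K (insertion g₁ g₂) := by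
  simpa using multigraphs_comp_formalSum (K := K) {g₁} {g₂}

theorem multigraphs_map_formalSum (σ : A ≃ B) (s : Multiset (Multigraph A)) :
    (multigraphs.{u, v} K).map σ (formalSum K s) =
      formalSum K (s.map (Multiset.map (Sym2.map σ))) :=
  mapDomain_formalSum _ _

theorem multigraphs_map_single (σ : A ≃ B) (g : Multigraph A) :
    (multigraphs.{u, v} K).map σ (Finsupp.single g 1) =
      Finsupp.single (g.map (Sym2.map σ)) 1 :=
  Finsupp.mapDomain_single

theorem rootedMultigraphs_comp_formalSum (s : Multiset (OrientedMultigraph (Option A) × Option A))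
    (t : Multiset (OrientedMultigraph B × B)) :
    (rootedMultigraphs.{u, v} K).comp (formalSum K s) (formalSum K t) =
      formalSum K (s.bind fun g₁ => t.bind fun g₂ => rootedInsertion g₁ g₂) := by
  change Finsupp.linearCombination K (fun g₁ =>
    Finsupp.linearCombination K fun g₂ => formalSum K (rootedInsertion g₁ g₂))
      (formalSum K s) _ = _
  induction s using Multiset.induction with
  | empty => simp
  | cons a s ih => simp [ih, linearCombination_formalSum]

theorem rootedMultigraphs_comp_single (g₁ : OrientedMultigraph (Option A) × Option A)
    (g₂ : OrientedMultigraph B × B) :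
    (rootedMultigraphs.{u, v} K).comp (Finsupp.single g₁ 1) (Finsupp.single g₂ 1) =
      formalSum K (rootedInsertion g₁ g₂) := by
  simpa using rootedMultigraphs_comp_formalSum (K := K) {g₁} {g₂}

theorem rootedMultigraphs_map_formalSum (σ : A ≃ B) (s : Multiset (OrientedMultigraph A × A)) :
    (rootedMultigraphs.{u, v} K).map σ (formalSum K s) =
      formalSum K (s.map (Prod.map (Multiset.map (Sym2.map (Prod.map σ id))) σ)) :=
  mapDomain_formalSum _ _

theorem rootedMultigraphs_map_single (σ : A ≃ B) (p : OrientedMultigraph A × A) :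
    (rootedMultigraphs.{u, v} K).map σ (Finsupp.single p 1) =
      Finsupp.single (p.1.map (Sym2.map (Prod.map σ id)), σ p.2) 1 :=
  Finsupp.mapDomain_single

end

section

variable {A A' B B' C : Type u} [Finite B] [Finite B'] [Finite C]

theorem insertion_map (σ : A ≃ A') (τ : B ≃ B') (g₁ : Multigraph (Option A)) (g₂ : Multigraph B) :
    insertion (g₁.map (Sym2.map σ.optionCongr)) (g₂.map (Sym2.map τ)) =
      (insertion g₁ g₂).map (Multiset.map (Sym2.map (σ.sumCongr τ))) := by
  have h : ∀ a, insertionEnds A' B' (σ.optionCongr a) =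
      (insertionEnds A B a).map (σ.sumCongr τ) := by
    rintro (_ | a)
    · simp [← allOf_map τ, Function.comp_def]
    · simp
  simp only [insertion_eq, reconnections_map, h, ← map_reconnections, Multiset.map_map,
    Function.comp_def, Multiset.map_add, Sym2.map_map]
  simp

/-- A second insertion, at a vertex outside of the multigraph `y` inserted first. -/
theorem insertion_insertion (f : Option A ⊕ B → Option A') (k : B → A' ⊕ C)
    (hf : ∀ b, insertionEnds A' C (f (Sum.inr b)) = {k b})
    (x : Multigraph (Option (Option A))) (y : Multigraph B) (z : Multigraph C) :
    ((insertion x y).bind fun h => insertion (h.map (Sym2.map f)) z) =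
      (reconnections (fun a => (insertionEnds (Option A) B a).bind
        fun b => insertionEnds A' C (f b)) x).map fun h =>
          h + (y.map (Sym2.map k) + z.map (Sym2.map Sum.inr)) := by
  simp only [insertion_eq, reconnections_map, Multiset.bind_map, ← Multiset.map_bind,
    reconnections_bind_add, hf, reconnections_singleton]
  simp [Multiset.bind_singleton, Multiset.map_map, add_assoc]

theorem insertion_parallel (x : Multigraph (Option (Option A))) (y : Multigraph B)
    (z : Multigraph C) :
    ((insertion x y).bind fun h => insertion (h.map (Sym2.map (starLeft A B))) z) =
      ((insertion (x.map (Sym2.map (starSwap A))) z).bind fun h =>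
        insertion (h.map (Sym2.map (starLeft A C))) y).map
          (Multiset.map (Sym2.map (sumExchange A B C))) := by
  rw [insertion_insertion _ (fun b => Sum.inl (Sum.inr b)) (fun b => rfl),
    insertion_insertion _ (fun b => Sum.inl (Sum.inr b)) (fun b => rfl)]
  rw [reconnections_map, Multiset.map_map]
  simp only [Function.comp_def, Multiset.map_add, Multiset.map_map, Sym2.map_map]
  have h : (fun a => (insertionEnds (Option A) B a).bind fun b =>
      insertionEnds (A ⊕ B) C (starLeft A B b)) =
      fun a => ((insertionEnds (Option A) C (starSwap A a)).bind fun b =>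
        insertionEnds (A ⊕ C) B (starLeft A C b)).map (sumExchange A B C) := by
    funext a
    rcases a with _ | _ | a <;>
    simp [starSwap, starLeft, Multiset.bind_map, Multiset.map_map, sumExchange,
      Multiset.bind_singleton, Function.comp_def]
  rw [h, ← map_reconnections, Multiset.map_map]
  refine Multiset.map_congr rfl fun k _ => ?_
  simp only [Function.comp_def]
  congr 1
  exact add_comm _ _

theorem insertion_assoc (x : Multigraph (Option A)) (y : Multigraph (Option B))
    (z : Multigraph C) :
    ((insertion x y).bind fun h => insertion (h.map (Sym2.map (starRight A B))) z) =
      ((insertion y z).bind (insertion x)).map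
        (Multiset.map (Sym2.map (Equiv.sumAssoc A B C).symm)) := by
  have h : (fun a => (insertionEnds A (Option B) a).bind fun b =>
      insertionEnds (A ⊕ B) C (starRight A B b)) =
      fun a => (insertionEnds A (B ⊕ C) a).map (Equiv.sumAssoc A B C).symm := by
    funext a
    rcases a with _ | a
    · simp [allOf_option, allOf_sum, starRight, Multiset.bind_map, Multiset.map_map,
        Multiset.bind_singleton, Function.comp_def, add_comm]
    · simp [starRight]
  have h' : (fun b => insertionEnds (A ⊕ B) C (starRight A B (Sum.inr b))) =
      fun b => (insertionEnds B C b).map fun c => (Equiv.sumAssoc A B C).symm (Sum.inr c) := by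
    funext b
    rcases b with _ | b <;> simp [starRight, Function.comp_def]
  simp only [insertion_eq, reconnections_map, Multiset.bind_map, ← Multiset.map_bind,
    reconnections_bind_add, h, h']
  simp only [Multiset.map_bind, Multiset.map_map, Multiset.map_add, Function.comp_def,
    Sym2.map_map, ← map_reconnections, Multiset.bind_map, ← add_assoc]
  rw [Multiset.bind_map_comm]
  simp only [Equiv.sumAssoc_symm_apply_inr_inr]

theorem insertion_one (x : Multigraph (Option A)) :
    insertion x (0 : Multigraph PUnit.{u + 1}) =
      {x.map (Sym2.map (Equiv.optionEquivSumPUnit.{u, u} A))} := by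
  have h : insertionEnds A PUnit.{u + 1} = fun a => {Equiv.optionEquivSumPUnit.{u, u} A a} := by
    funext a
    rcases a with _ | a <;> simp [allOf_unique]
  simp [insertion_eq, h, reconnections_singleton]

theorem one_insertion (y : Multigraph B) :
    insertion (0 : Multigraph (Option A)) y = {y.map (Sym2.map Sum.inr)} := by
  simp [insertion_eq, reconnections_zero]

end

variable {K : Type v} [Field K]

theorem multigraphs_laws : (multigraphs.{u, v} K).Laws := by
  refine OperadData.Laws.of_span (ι := Multigraph) (fun V _ g => Finsupp.single g 1)
    (fun V _ p x => multigraphs_induction x) ?_ ?_ ?_ ?_ ?_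
  · intro A A' B B' _ _ _ _ σ τ i j
    rw [multigraphs_map_single, multigraphs_map_single, multigraphs_comp_single,
      multigraphs_comp_single, multigraphs_map_formalSum, insertion_map]
  · intro A B C _ _ _ i j k
    rw [multigraphs_map_single, multigraphs_comp_single, multigraphs_comp_single,
      multigraphs_map_formalSum, multigraphs_map_formalSum, ← formalSum_singleton k,
      ← formalSum_singleton j, multigraphs_comp_formalSum, multigraphs_comp_formalSum,
      multigraphs_map_formalSum]
    simp only [Multiset.bind_map, Multiset.singleton_bind]
    rw [insertion_parallel]
  · intro A B C _ _ _ i j k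
    rw [multigraphs_comp_single, multigraphs_comp_single,
      multigraphs_map_formalSum, ← formalSum_singleton k,
      ← formalSum_singleton i, multigraphs_comp_formalSum, multigraphs_comp_formalSum,
      multigraphs_map_formalSum]
    simp only [Multiset.bind_map, Multiset.singleton_bind]
    rw [insertion_assoc]
  · intro A _ i
    refine (multigraphs_comp_single i 0).trans ?_
    rw [insertion_one, multigraphs_map_single, formalSum_singleton]
  · intro B _ j
    have := multigraphs_map_single (K := K)
      (Equiv.ofUnique PUnit.{u + 1} (Option PEmpty.{u + 1})) 0
    refine (congrArg (fun x => (multigraphs K).map _ ((multigraphs K).comp x _)) this).trans ?_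
    rw [Multiset.map_zero, multigraphs_comp_single, one_insertion, formalSum_singleton,
      multigraphs_map_single]
    have : ((Equiv.emptySum PEmpty.{u + 1} B) ∘ Sum.inr) = id := by ext b; rfl
    rw [Multiset.map_map, ← Sym2.map_comp, this]
    simp only [Sym2.map_id, Multiset.map_id]
    rfl

section

variable {A A' B B' C : Type u} [Finite B] [Finite B'] [Finite C]

theorem rootedInsertion_map (σ : A ≃ A') (τ : B ≃ B')
    (p₁ : OrientedMultigraph (Option A) × Option A) (p₂ : OrientedMultigraph B × B) :
    rootedInsertion (p₁.1.map (Sym2.map (Prod.map σ.optionCongr id)), σ.optionCongr p₁.2)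
        (p₂.1.map (Sym2.map (Prod.map τ id)), τ p₂.2) =
      (rootedInsertion p₁ p₂).map (Prod.map
        (Multiset.map (Sym2.map (Prod.map (σ.sumCongr τ) id))) (σ.sumCongr τ)) := by
  have h : ∀ a, rootedEnds A' (τ p₂.2) (Prod.map σ.optionCongr id a) =
      (rootedEnds A p₂.2 a).map (Prod.map (σ.sumCongr τ) id) := by
    rintro ⟨_ | a, _ | _⟩ <;> simp [← allOf_map τ]
  have h' : newRoot (τ p₂.2) (σ.optionCongr p₁.2) = σ.sumCongr τ (newRoot p₂.2 p₁.2) := by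
    rcases p₁ with ⟨p₁, _ | r⟩ <;> simp
  simp only [rootedInsertion_eq, reconnections_map, h, h', ← map_reconnections, Multiset.map_map]
  simp [Prod.map_def, Sym2.map_map, Function.comp_def]

/-- A second rooted insertion, at a vertex outside of the multigraph `y` inserted first. -/
theorem rootedInsertion_rootedInsertion (f : Option A ⊕ B → Option A') (k : B → A' ⊕ C)
    (x : OrientedMultigraph (Option (Option A)) × Option (Option A))
    (y : OrientedMultigraph B × B) (z : OrientedMultigraph C × C)
    (hf : ∀ b l, rootedEnds A' z.2 (f (Sum.inr b), l) = {(k b, l)}) :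
    ((rootedInsertion x y).bind fun h =>
        rootedInsertion (h.1.map (Sym2.map (Prod.map f id)), f h.2) z) =
      (reconnections (fun a => (rootedEnds (Option A) y.2 a).bind
        fun b => rootedEnds A' z.2 (f b.1, b.2)) x.1).map fun h =>
          (h + (y.1.map (Sym2.map (Prod.map k id)) +
            z.1.map (Sym2.map (Prod.map Sum.inr id))), newRoot z.2 (f (newRoot y.2 x.2))) := by
  have hf' : (fun b => rootedEnds A' z.2 (Prod.map f id (Prod.map Sum.inr id b))) =
      fun b => {Prod.map k id b} := by
    funext ⟨b, l⟩
    simp [hf]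
  have hf'' : (fun a => (rootedEnds (Option A) y.2 a).bind
        fun b => rootedEnds A' z.2 (Prod.map f id b)) =
      fun a => (rootedEnds (Option A) y.2 a).bind fun b => rootedEnds A' z.2 (f b.1, b.2) := rfl
  simp only [rootedInsertion_eq, reconnections_map, Multiset.bind_map, ← Multiset.map_bind,
    reconnections_bind_add, hf', hf'', reconnections_singleton]
  simp [Multiset.bind_singleton, Multiset.map_map, add_assoc]

theorem rootedInsertion_parallel
    (x : OrientedMultigraph (Option (Option A)) × Option (Option A))
    (y : OrientedMultigraph B × B) (z : OrientedMultigraph C × C) :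
    ((rootedInsertion x y).bind fun h => rootedInsertion
        (h.1.map (Sym2.map (Prod.map (starLeft A B) id)), starLeft A B h.2) z) =
      ((rootedInsertion (x.1.map (Sym2.map (Prod.map (starSwap A) id)), starSwap A x.2) z).bind
        fun h => rootedInsertion
          (h.1.map (Sym2.map (Prod.map (starLeft A C) id)), starLeft A C h.2) y).map
          (Prod.map (Multiset.map (Sym2.map (Prod.map (sumExchange A B C) id)))
            (sumExchange A B C)) := by
  rw [rootedInsertion_rootedInsertion _ (fun b => Sum.inl (Sum.inr b)) _ _ _ (fun b l => rfl),
    rootedInsertion_rootedInsertion _ (fun b => Sum.inl (Sum.inr b)) _ _ _ (fun b l => rfl)]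
  rw [reconnections_map, Multiset.map_map]
  have h : (fun a => (rootedEnds (Option A) y.2 a).bind fun b =>
      rootedEnds (A ⊕ B) z.2 (starLeft A B b.1, b.2)) =
      fun a => ((rootedEnds (Option A) z.2 (Prod.map (starSwap A) id a)).bind fun b =>
        rootedEnds (A ⊕ C) y.2 (starLeft A C b.1, b.2)).map
          (Prod.map (sumExchange A B C) id) := by
    funext a
    rcases a with ⟨_ | _ | a, _ | _⟩ <;>
    simp [starSwap, starLeft, Multiset.bind_map, Multiset.map_map, sumExchange,
      Multiset.bind_singleton, Function.comp_def]
  have h' : newRoot z.2 (starLeft A B (newRoot y.2 x.2)) =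
      sumExchange A B C (newRoot y.2 (starLeft A C (newRoot z.2 (starSwap A x.2)))) := by
    rcases x with ⟨x, _ | _ | r⟩ <;> rfl
  rw [h, h', ← map_reconnections, Multiset.map_map]
  refine Multiset.map_congr rfl fun k _ => ?_
  simp only [Function.comp_def, Prod.map_def, Multiset.map_add, Multiset.map_map, Sym2.map_map]
  congr 2
  exact add_comm _ _

theorem rootedInsertion_assoc (x : OrientedMultigraph (Option A) × Option A)
    (y : OrientedMultigraph (Option B) × Option B) (z : OrientedMultigraph C × C) :
    ((rootedInsertion x y).bind fun h => rootedInsertion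
        (h.1.map (Sym2.map (Prod.map (starRight A B) id)), starRight A B h.2) z) =
      ((rootedInsertion y z).bind (rootedInsertion x)).map
        (Prod.map (Multiset.map (Sym2.map (Prod.map (Equiv.sumAssoc A B C).symm id)))
          (Equiv.sumAssoc A B C).symm) := by
  have h : (fun a => (rootedEnds A y.2 a).bind fun b =>
      rootedEnds (A ⊕ B) z.2 (Prod.map (starRight A B) id b)) =
      fun a => (rootedEnds A (newRoot z.2 y.2) a).map
        (Prod.map (Equiv.sumAssoc A B C).symm id) := by
    funext a
    rcases y with ⟨y, _ | r⟩ <;> rcases a with ⟨_ | a, _ | _⟩ <;>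
    simp [allOf_option, allOf_sum, starRight, Multiset.bind_map, Multiset.map_map,
        Multiset.bind_singleton, Function.comp_def, add_comm]
  have h' : (fun b => rootedEnds (A ⊕ B) z.2
        (Prod.map (starRight A B) id (Prod.map Sum.inr id b))) =
      fun b => (rootedEnds B z.2 b).map
        (Prod.map (fun c => (Equiv.sumAssoc A B C).symm (Sum.inr c)) id) := by
    funext b
    rcases b with ⟨_ | b, _ | _⟩ <;> simp [starRight, Function.comp_def]
  have h'' : newRoot z.2 (starRight A B (newRoot y.2 x.2)) =
      (Equiv.sumAssoc A B C).symm (newRoot (newRoot z.2 y.2) x.2) := by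
    rcases x with ⟨x, _ | r⟩ <;> rcases y with ⟨y, _ | r⟩ <;> rfl
  simp only [rootedInsertion_eq, reconnections_map, Multiset.bind_map, ← Multiset.map_bind,
    reconnections_bind_add, h, h', h'']
  simp only [Multiset.map_bind, Multiset.map_map, Multiset.map_add, Function.comp_def,
    Sym2.map_map, ← map_reconnections, Multiset.bind_map, ← add_assoc, Prod.map_def]
  rw [Multiset.bind_map_comm]
  simp only [Equiv.sumAssoc_symm_apply_inr_inr, id]

theorem rootedInsertion_one (x : OrientedMultigraph (Option A) × Option A) :
    rootedInsertion x ((0 : OrientedMultigraph PUnit.{u + 1}), PUnit.unit) =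
      {(x.1.map (Sym2.map (Prod.map (Equiv.optionEquivSumPUnit.{u, u} A) id)),
        Equiv.optionEquivSumPUnit.{u, u} A x.2)} := by
  have h : rootedEnds A PUnit.unit.{u + 1} =
      fun a => {Prod.map (Equiv.optionEquivSumPUnit.{u, u} A) id a} := by
    funext a
    rcases a with ⟨_ | a, _ | _⟩ <;> simp [allOf_unique]
  have h' : newRoot PUnit.unit.{u + 1} x.2 = Equiv.optionEquivSumPUnit.{u, u} A x.2 := by
    rcases x with ⟨x, _ | r⟩ <;> rfl
  simp [rootedInsertion_eq, h, h', reconnections_singleton]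

theorem one_rootedInsertion (y : OrientedMultigraph B × B) :
    rootedInsertion ((0 : OrientedMultigraph (Option A)), none) y =
      {(y.1.map (Sym2.map (Prod.map Sum.inr id)), Sum.inr y.2)} := by
  simp [rootedInsertion_eq, reconnections_zero]

end

theorem rootedMultigraphs_laws : (rootedMultigraphs.{u, v} K).Laws := by
  refine OperadData.Laws.of_span (ι := fun V => OrientedMultigraph V × V)
    (fun V _ g => Finsupp.single g 1)
    (fun V _ p x => rootedMultigraphs_induction x) ?_ ?_ ?_ ?_ ?_
  · intro A A' B B' _ _ _ _ σ τ i j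
    rw [rootedMultigraphs_map_single, rootedMultigraphs_map_single, rootedMultigraphs_comp_single,
      rootedMultigraphs_comp_single, rootedMultigraphs_map_formalSum, rootedInsertion_map]
  · intro A B C _ _ _ i j k
    rw [rootedMultigraphs_map_single, rootedMultigraphs_comp_single, rootedMultigraphs_comp_single,
      rootedMultigraphs_map_formalSum, rootedMultigraphs_map_formalSum, ← formalSum_singleton k,
      ← formalSum_singleton j, rootedMultigraphs_comp_formalSum, rootedMultigraphs_comp_formalSum,
      rootedMultigraphs_map_formalSum]
    simp only [Multiset.bind_map, Multiset.singleton_bind]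
    exact congrArg _ (rootedInsertion_parallel i j k)
  · intro A B C _ _ _ i j k
    rw [rootedMultigraphs_comp_single, rootedMultigraphs_comp_single,
      rootedMultigraphs_map_formalSum, ← formalSum_singleton k,
      ← formalSum_singleton i, rootedMultigraphs_comp_formalSum, rootedMultigraphs_comp_formalSum,
      rootedMultigraphs_map_formalSum]
    simp only [Multiset.bind_map, Multiset.singleton_bind]
    exact congrArg _ (rootedInsertion_assoc i j k)
  · intro A _ i
    refine (rootedMultigraphs_comp_single i (0, PUnit.unit)).trans ?_
    rw [rootedInsertion_one, rootedMultigraphs_map_single, formalSum_singleton]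
  · intro B _ j
    have := rootedMultigraphs_map_single (K := K)
      (Equiv.ofUnique PUnit.{u + 1} (Option PEmpty.{u + 1})) (0, PUnit.unit)
    refine (congrArg (fun x =>
      (rootedMultigraphs K).map _ ((rootedMultigraphs K).comp x _)) this).trans ?_
    rw [Multiset.map_zero, rootedMultigraphs_comp_single]
    change (rootedMultigraphs K).map _ (formalSum K (rootedInsertion (0, none) j)) = _
    rw [one_rootedInsertion, formalSum_singleton, rootedMultigraphs_map_single]
    have : (Prod.map (Equiv.emptySum PEmpty.{u + 1} B) id ∘ Prod.map Sum.inr id) =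
        (id : B × Bool → _) := by ext b <;> rfl
    rw [Multiset.map_map, ← Sym2.map_comp, this]
    simp only [Sym2.map_id, Multiset.map_id]
    rfl

/-! ### Spanning trees and parent functions -/

namespace Multigraph

variable {V : Type u}

theorem toSimple_adj {g : Multigraph V} {a b : V} : g.toSimple.Adj a b ↔ s(a, b) ∈ g ∧ a ≠ b := by
  simp [toSimple]

theorem Connected.mono {g g' : Multigraph V} (h : g ≤ g') (hg : g.Connected) : g'.Connected := by
  refine SimpleGraph.Connected.mono (fun a b hab => ?_) hg
  rw [toSimple_adj] at hab ⊢
  exact ⟨Multiset.mem_of_le h hab.1, hab.2⟩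

theorem mem_edgeSet_toSimple {g : Multigraph V} {e : Sym2 V} :
    e ∈ g.toSimple.edgeSet ↔ e ∈ g ∧ ¬ e.IsDiag := by
  induction e with | _ a b => simp [toSimple_adj]

/-- A multigraph is a tree when it is connected and has one edge less than vertices: loops and
repeated edges do not help to connect the vertices. -/
theorem isTree_iff [Finite V] {g : Multigraph V} :
    g.IsTree ↔ g.Connected ∧ Multiset.card g + 1 = Nat.card V := by
  classical
  have hcard : Nat.card g.toSimple.edgeSet = (g.toFinset.filter fun e => ¬ e.IsDiag).card := by
    rw [Nat.card_coe_set_eq, ← Set.ncard_coe_finset]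
    congr 1
    ext e
    simp [mem_edgeSet_toSimple]
  have hle := Finset.card_filter_le g.toFinset fun e => ¬ e.IsDiag
  have hle' := Multiset.toFinset_card_le g
  constructor
  · rintro ⟨⟨hnd, hdiag⟩, ht⟩
    rw [SimpleGraph.isTree_iff_connected_and_card, hcard,
      Finset.filter_true_of_mem (by simpa using hdiag), Multiset.toFinset_card_of_nodup hnd] at ht
    exact ht
  · rintro ⟨hc, h⟩
    have hc' := SimpleGraph.Connected.card_vert_le_card_edgeSet_add_one hc
    refine ⟨⟨Multiset.toFinset_card_eq_card_iff_nodup.1 (by omega), fun e he => ?_⟩, ?_⟩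
    · exact Finset.card_filter_eq_iff.1 (show (g.toFinset.filter fun e => ¬ e.IsDiag).card =
        g.toFinset.card by omega) e (by simpa using he)
    · rw [SimpleGraph.isTree_iff_connected_and_card]
      exact ⟨hc, by omega⟩

end Multigraph

section

variable {V : Type u}

/-- `par v` is the parent of `v` for every vertex `v ≠ r`, in some tree with root `r`; that all
paths of parents end at `r` is expressed by a rank which decreases along them. The value `par r` is
irrelevant. -/
def IsParent (r : V) (par : V → V) : Prop :=
  ∃ rank : V → ℕ, ∀ v, v ≠ r → rank (par v) < rank v

theorem IsParent.ne {r : V} {par : V → V} (h : IsParent r par) {v : V} (hv : v ≠ r) :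
    par v ≠ v := by
  obtain ⟨rank, h⟩ := h
  intro he
  have := h v hv
  rw [he] at this
  exact this.false

theorem IsParent.exists_depth {r : V} {par : V → V} (h : IsParent r par) :
    ∃ d : V → ℕ, d r = 0 ∧ ∀ v, v ≠ r → d v = d (par v) + 1 := by
  classical
  obtain ⟨rank, h⟩ := h
  let F : ∀ v, (∀ w, rank w < rank v → ℕ) → ℕ :=
    fun v ih => if hv : v = r then 0 else ih (par v) (h v hv) + 1
  refine ⟨(measure rank).wf.fix F, ?_, fun v hv => ?_⟩
  · rw [WellFounded.fix_eq]
    simp [F]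
  · rw [WellFounded.fix_eq]
    simp [F, hv]

variable [Finite V]

open Classical in
/-- The vertices different from `r`. -/
def nonRoots (r : V) : Multiset V := (allOf V).filter (· ≠ r)

@[simp] theorem mem_nonRoots {r v : V} : v ∈ nonRoots r ↔ v ≠ r := by simp [nonRoots]

theorem nodup_nonRoots (r : V) : (nonRoots r).Nodup := by
  classical exact (nodup_allOf V).filter _

theorem card_nonRoots (r : V) : Multiset.card (nonRoots r) + 1 = Nat.card V := by
  classical
  have h : nonRoots r = (allOf V).erase r := by
    rw [(nodup_allOf V).erase_eq_filter]
    unfold nonRoots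
    congr
  let _ := Fintype.ofFinite V
  have hc : Multiset.card (allOf V) = Nat.card V := Nat.card_eq_fintype_card.symm
  rw [h, Multiset.card_erase_add_one (mem_allOf r), hc]

/-- The tree with root `r` and parent function `par`. -/
def treeOf (r : V) (par : V → V) : Multigraph V := (nonRoots r).map fun v => s(par v, v)

/-- The tree with root `r` and parent function `par`, with labelled parent ends. -/
def orientedTreeOf (r : V) (par : V → V) : OrientedMultigraph V :=
  (nonRoots r).map fun v => s((par v, true), (v, false))

theorem card_treeOf (r : V) (par : V → V) : Multiset.card (treeOf r par) + 1 = Nat.card V := by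
  rw [treeOf, Multiset.card_map, card_nonRoots]

theorem card_orientedTreeOf (r : V) (par : V → V) :
    Multiset.card (orientedTreeOf r par) + 1 = Nat.card V := by
  rw [orientedTreeOf, Multiset.card_map, card_nonRoots]

theorem nodup_treeOf {r : V} {par : V → V} (h : IsParent r par) : (treeOf r par).Nodup := by
  obtain ⟨rank, h⟩ := h
  refine (nodup_nonRoots r).map_on fun v hv w hw hvw => ?_
  rw [mem_nonRoots] at hv hw
  rcases Sym2.eq_iff.1 hvw with ⟨-, h2⟩ | ⟨h1, h2⟩
  · exact h2
  · have := h v hv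
    have := h w hw
    rw [h1] at *
    rw [← h2] at *
    omega

theorem connected_treeOf {r : V} {par : V → V} (h : IsParent r par) :
    (treeOf r par).Connected := by
  refine (SimpleGraph.connected_iff_exists_forall_reachable _).2 ⟨r, fun w => ?_⟩
  obtain ⟨rank, hr⟩ := id h
  induction hn : rank w using Nat.strong_induction_on generalizing w with
  | _ n ih =>
    by_cases hw : w = r
    · rw [hw]
    · refine (ih (rank (par w)) (hn ▸ hr w hw) (par w) rfl).trans (SimpleGraph.Adj.reachable ?_)
      rw [Multigraph.toSimple_adj]
      exact ⟨Multiset.mem_map.2 ⟨w, mem_nonRoots.2 hw, rfl⟩, h.ne hw⟩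

theorem isTree_treeOf {r : V} {par : V → V} (h : IsParent r par) : (treeOf r par).IsTree :=
  Multigraph.isTree_iff.2 ⟨connected_treeOf h, card_treeOf r par⟩

/-- In a connected multigraph every vertex has a neighbour closer to the root, which may be taken
as its parent. -/
theorem Multigraph.Connected.exists_parent {g : Multigraph V} (hg : g.Connected) (r : V) :
    ∃ par : V → V, (∀ v, v ≠ r → g.toSimple.dist r (par v) < g.toSimple.dist r v) ∧
      treeOf r par ≤ g := by
  have : ∀ v, ∃ w, v ≠ r → g.toSimple.dist r w < g.toSimple.dist r v ∧ s(w, v) ∈ g := by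
    intro v
    by_cases hv : v = r
    · exact ⟨v, fun h => (h hv).elim⟩
    obtain ⟨p, hp⟩ := SimpleGraph.Connected.exists_walk_length_eq_dist hg v r
    cases p with
    | nil => exact (hv rfl).elim
    | @cons _ w _ hadj q =>
      refine ⟨w, fun _ => ⟨?_, ?_⟩⟩
      · rw [SimpleGraph.dist_comm, SimpleGraph.dist_comm (u := r), ← hp]
        exact (SimpleGraph.dist_le q).trans_lt (by simp)
      · rw [Sym2.eq_swap]
        exact (toSimple_adj.1 hadj).1
  choose par hpar using this
  have h1 : ∀ v, v ≠ r → g.toSimple.dist r (par v) < g.toSimple.dist r v :=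
    fun v hv => (hpar v hv).1
  refine ⟨par, h1, (Multiset.le_iff_subset (nodup_treeOf ⟨_, h1⟩)).2 fun e he => ?_⟩
  obtain ⟨v, hv, rfl⟩ := Multiset.mem_map.1 he
  exact (hpar v (mem_nonRoots.1 hv)).2

theorem Multigraph.Connected.exists_spanningTree {g : Multigraph V} (hg : g.Connected) :
    ∃ t : Multigraph V, t.IsSpanningTree g := by
  obtain ⟨r⟩ := hg.nonempty
  obtain ⟨par, hpar, hle⟩ := hg.exists_parent r
  exact ⟨_, isTree_treeOf ⟨_, hpar⟩, hle⟩

theorem Multigraph.IsTree.exists_parent {t : Multigraph V} (ht : t.IsTree) (r : V) :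
    ∃ par : V → V, IsParent r par ∧ t = treeOf r par := by
  have ht' := isTree_iff.1 ht
  obtain ⟨par, hpar, hle⟩ := ht'.1.exists_parent r
  refine ⟨par, ⟨_, hpar⟩, (Multiset.eq_of_le_of_card_le hle ?_).symm⟩
  have := card_treeOf r par
  omega

/-- The distance to the root in `treeOf r par` is the depth, as the depths of two adjacent vertices
differ by one. -/
theorem dist_treeOf {r : V} {par : V → V} (h : IsParent r par) {d : V → ℕ} (hr : d r = 0)
    (hd : ∀ v, v ≠ r → d v = d (par v) + 1) (v : V) : (treeOf r par).toSimple.dist r v = d v := by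
  have hadj : ∀ a b, (treeOf r par).toSimple.Adj a b → d b ≤ d a + 1 := by
    intro a b hab
    obtain ⟨w, hw, he⟩ := Multiset.mem_map.1 (Multigraph.toSimple_adj.1 hab).1
    have := hd w (mem_nonRoots.1 hw)
    rcases Sym2.eq_iff.1 he with ⟨rfl, rfl⟩ | ⟨rfl, rfl⟩ <;> omega
  have hwalk : ∀ a b (p : (treeOf r par).toSimple.Walk a b), d b ≤ d a + p.length := by
    intro a b p
    induction p with
    | nil => simp
    | cons h p ih =>
      have := hadj _ _ h
      simp only [SimpleGraph.Walk.length_cons]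
      omega
  refine le_antisymm ?_ ?_
  · obtain ⟨rank, hrank⟩ := id h
    induction hn : rank v using Nat.strong_induction_on generalizing v with
    | _ n ih =>
      by_cases hv : v = r
      · simp [hv]
      · have h1 := ih _ (hn ▸ hrank v hv) (par v) rfl
        have h2 : (treeOf r par).toSimple.Adj (par v) v := Multigraph.toSimple_adj.2
          ⟨Multiset.mem_map.2 ⟨v, mem_nonRoots.2 hv, rfl⟩, h.ne hv⟩
        have h3 := (connected_treeOf h).dist_triangle (u := r) (v := par v) (w := v)
        rw [SimpleGraph.dist_eq_one_iff_adj.2 h2] at h3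
        rw [hd v hv]
        omega
  · obtain ⟨p, hp⟩ := SimpleGraph.Connected.exists_walk_length_eq_dist (connected_treeOf h) r v
    have := hwalk _ _ p
    omega

theorem orientTree_treeOf {r : V} {par : V → V} (h : IsParent r par) :
    orientTree (treeOf r par) r = orientedTreeOf r par := by
  obtain ⟨d, hr, hd⟩ := h.exists_depth
  have hdist := dist_treeOf h hr hd
  simp only [orientTree, hdist]
  simp only [treeOf, orientedTreeOf, Multiset.map_map]
  refine Multiset.map_congr rfl fun v hv => ?_
  have := hd v (mem_nonRoots.1 hv)
  simp [this]

end

section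

variable {V : Type u}

@[simp] theorem underlying_add (p q : OrientedMultigraph V) :
    OrientedMultigraph.underlying (p + q) = p.underlying + q.underlying :=
  Multiset.map_add _ _ _

@[simp] theorem card_underlying (p : OrientedMultigraph V) :
    Multiset.card p.underlying = Multiset.card p := Multiset.card_map _ _

@[simp] theorem underlying_labelAll (g : Multigraph V) : (labelAll g).underlying = g := by
  simp [labelAll, OrientedMultigraph.underlying, Multiset.map_map, Sym2.map_map]

@[simp] theorem underlying_orientTree (t : Multigraph V) (r : V) :
    (orientTree t r).underlying = t := by
  simp only [orientTree, OrientedMultigraph.underlying, Multiset.map_map]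
  conv_rhs => rw [← Multiset.map_id t]
  refine Multiset.map_congr rfl fun e _ => ?_
  induction e with | _ a b => simp

@[simp] theorem card_orientTree (t : Multigraph V) (r : V) :
    Multiset.card (orientTree t r) = Multiset.card t := Multiset.card_map _ _

theorem underlying_orient {g t : Multigraph V} (h : t ≤ g) (r : V) :
    (orient g t r).underlying = g := by
  classical
  rw [orient, underlying_add, underlying_orientTree, underlying_labelAll]
  exact add_tsub_cancel_of_le h

theorem orient_self (t : Multigraph V) (r : V) : orient t t r = orientTree t r := by
  classical
  rw [orient, tsub_self]
  exact add_zero _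

theorem Multigraph.IsTree.isSpanningTree_self {t : Multigraph V} (ht : t.IsTree) :
    t.IsSpanningTree t := ⟨ht, le_rfl⟩

variable [Finite V]

@[simp] theorem underlying_orientedTreeOf (r : V) (par : V → V) :
    (orientedTreeOf r par).underlying = treeOf r par := by
  simp [orientedTreeOf, OrientedMultigraph.underlying, treeOf, Function.comp_def]

/-- The rooted oriented multigraphs which come from a spanning tree and a root: each vertex apart
from the root is the unlabelled end of exactly one edge, leading to its parent, and all other ends
are labelled. -/
def IsTreeOriented (p : OrientedMultigraph V × V) : Prop :=
  ∃ (par : V → V) (q : Multigraph V), IsParent p.2 par ∧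
    p.1 = orientedTreeOf p.2 par + labelAll q

theorem IsTreeOriented.connected {p : OrientedMultigraph V × V} (h : IsTreeOriented p) :
    p.1.underlying.Connected := by
  obtain ⟨par, q, hpar, h⟩ := h
  rw [h]
  exact (connected_treeOf hpar).mono (by simp)

theorem isTreeOriented_orient {g t : Multigraph V} (h : t.IsSpanningTree g) (r : V) :
    IsTreeOriented (orient g t r, r) := by
  obtain ⟨par, hpar, rfl⟩ := h.1.exists_parent r
  exact ⟨par, _, hpar, by rw [orient, orientTree_treeOf hpar]⟩

theorem IsTreeOriented.exists_orient {p : OrientedMultigraph V × V} (h : IsTreeOriented p) :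
    ∃ t : Multigraph V, t.IsSpanningTree p.1.underlying ∧
      p.1 = orient p.1.underlying t p.2 := by
  classical
  obtain ⟨par, q, hpar, h⟩ := h
  have : p.1.underlying = treeOf p.2 par + q := by simp [h]
  rw [this]
  refine ⟨treeOf p.2 par, ⟨isTree_treeOf hpar, by simp⟩, ?_⟩
  rw [orient, orientTree_treeOf hpar, h]
  congr 2
  exact (add_tsub_cancel_left _ _).symm

theorem exists_orientTree_iff {p : OrientedMultigraph V × V} :
    (∃ t : Multigraph V, t.IsTree ∧ p = (orientTree t p.2, p.2)) ↔
      IsTreeOriented p ∧ Multiset.card p.1 + 1 = Nat.card V := by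
  constructor
  · rintro ⟨t, ht, h⟩
    rw [h]
    refine ⟨?_, ?_⟩
    · rw [← orient_self]
      exact isTreeOriented_orient ht.isSpanningTree_self _
    · rw [card_orientTree]
      exact (Multigraph.isTree_iff.1 ht).2
  · rintro ⟨⟨par, q, hpar, h⟩, hc⟩
    have h1 := card_orientedTreeOf p.2 par
    have hq : q = 0 := by
      rw [← Multiset.card_eq_zero]
      rw [h, Multiset.card_add, labelAll, Multiset.card_map] at hc
      omega
    refine ⟨treeOf p.2 par, isTree_treeOf hpar, Prod.ext ?_ rfl⟩
    rw [orientTree_treeOf hpar, h, hq]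
    exact add_zero _

theorem IsTreeOriented.map {W : Type u} [Finite W] {p : OrientedMultigraph V × V}
    (h : IsTreeOriented p) (σ : V ≃ W) :
    IsTreeOriented (p.1.map (Sym2.map (Prod.map σ id)), σ p.2) := by
  obtain ⟨par, q, ⟨rank, hrank⟩, h⟩ := h
  refine ⟨fun w => σ (par (σ.symm w)), q.map (Sym2.map σ), ⟨fun w => rank (σ.symm w), ?_⟩, ?_⟩
  · intro w hw
    have := hrank (σ.symm w) (fun h => hw (by simp [← h]))
    simpa using this
  · have hn : nonRoots (σ p.2) = (nonRoots p.2).map σ := by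
      rw [(nodup_nonRoots _).ext ((nodup_nonRoots _).map σ.injective)]
      intro w
      obtain ⟨v, rfl⟩ := σ.surjective w
      simp
    simp [h, orientedTreeOf, labelAll, hn, Sym2.map_map, Function.comp_def, Multiset.map_map]

end

/-! ### Insertion and spanning trees -/

section

variable {A B : Type u} [Finite B]

theorem nonRoots_newRoot [Finite A] (r₂ : B) (r₁ : Option A) :
    nonRoots (newRoot r₂ r₁) =
      (nonRoots r₁).map (newRoot r₂) + (nonRoots r₂).map (Sum.inr : B → A ⊕ B) := by
  have hinj : Function.Injective (newRoot (A := A) r₂) := by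
    rintro (_ | a) (_ | a') h <;> simp_all
  rw [(nodup_nonRoots _).ext]
  · rintro (a | b)
    · simp only [mem_nonRoots, Multiset.mem_add, Multiset.mem_map, reduceCtorEq, and_false,
        exists_false, or_false]
      constructor
      · intro h
        exact ⟨some a, fun h' => h (by rw [← h']; rfl), rfl⟩
      · rintro ⟨x, hx, h⟩ h'
        exact hx (hinj (h.trans h'))
    · simp only [mem_nonRoots, Multiset.mem_add, Multiset.mem_map, Sum.inr.injEq,
        exists_eq_right]
      constructor
      · intro h
        by_cases hb : b = r₂
        · exact Or.inl ⟨none, fun h' => h (by rw [← h', hb]; rfl), by rw [hb]; rfl⟩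
        · exact Or.inr hb
      · rintro (⟨x, hx, h⟩ | hb) h'
        · exact hx (hinj (h.trans h'))
        · rcases r₁ with _ | a
          · exact hb (Sum.inr_injective h')
          · cases h'
  · rw [Multiset.nodup_add]
    refine ⟨(nodup_nonRoots _).map hinj, (nodup_nonRoots _).map Sum.inr_injective, ?_⟩
    rw [Multiset.disjoint_left]
    intro x hx hx'
    obtain ⟨b, hb, rfl⟩ := Multiset.mem_map.1 hx'
    obtain ⟨_ | a, ha, h⟩ := Multiset.mem_map.1 hx
    · exact mem_nonRoots.1 hb (Sum.inr_injective h).symm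
    · cases h

/-- If `x v` is the vertex to which the parent end of `v` is moved, then the result of a rooted
insertion of trees has the following parent function. -/
def insertedParent (par₂ : B → B) (r₂ : B) (x : Option A → A ⊕ B) (v : A ⊕ B) : A ⊕ B :=
  open Classical in
  match v with
  | Sum.inl a => x (some a)
  | Sum.inr b => if b = r₂ then x none else Sum.inr (par₂ b)

theorem isParent_insertedParent {r₁ : Option A} {par₁ : Option A → Option A} {r₂ : B}
    {par₂ : B → B} (h₁ : IsParent r₁ par₁) (h₂ : IsParent r₂ par₂) {x : Option A → A ⊕ B}
    (hx : ∀ v, v ≠ r₁ → x v ∈ insertionEnds A B (par₁ v)) :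
    IsParent (newRoot r₂ r₁) (insertedParent par₂ r₂ x) := by
  obtain ⟨rank₁, h₁⟩ := h₁
  obtain ⟨rank₂, h₂⟩ := h₂
  obtain ⟨N, hN⟩ : ∃ N, ∀ b, rank₂ b < N := by
    obtain ⟨M, hM⟩ := (Set.finite_range rank₂).bddAbove
    exact ⟨M + 1, fun b => Nat.lt_succ_of_le (hM ⟨b, rfl⟩)⟩
  -- Lexicographic order: first the rank in the outer tree, then the rank in the inserted one.
  let rank : A ⊕ B → ℕ := Sum.elim (fun a => rank₁ (some a) * N)
    fun b => rank₁ none * N + rank₂ b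
  have key : ∀ k l m, k < l → m < N → k * N + m < l * N := by
    intro k l m hkl hm
    calc k * N + m < (k + 1) * N := by rw [add_mul, one_mul]; omega
      _ ≤ l * N := Nat.mul_le_mul_right N hkl
  have hpar : ∀ v, v ≠ r₁ → rank (x v) < rank₁ v * N := by
    intro v hv
    have hmem := hx v hv
    have hlt := h₁ v hv
    cases hp : par₁ v with
    | none =>
      rw [hp] at hmem hlt
      obtain ⟨b, -, hb⟩ := Multiset.mem_map.1 hmem
      rw [← hb]
      exact key _ _ _ hlt (hN b)
    | some a =>
      rw [hp] at hmem hlt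
      rw [Multiset.mem_singleton.1 hmem]
      rcases isEmpty_or_nonempty B with hB | ⟨⟨b⟩⟩
      · exact (hB.false r₂).elim
      · exact key _ _ 0 hlt ((Nat.zero_le _).trans_lt (hN b))
  refine ⟨rank, ?_⟩
  rintro (a | b) hv
  · exact hpar (some a) fun h => hv (by rw [← h]; rfl)
  · by_cases hb : b = r₂
    · have : insertedParent par₂ r₂ x (Sum.inr b) = x none := by simp [insertedParent, hb]
      rw [this]
      exact (hpar none fun h => hv (by rw [← h, hb]; rfl)).trans_le (Nat.le_add_right _ _)
    · have : insertedParent par₂ r₂ x (Sum.inr b) = Sum.inr (par₂ b) := by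
        simp [insertedParent, hb]
      rw [this]
      exact Nat.add_lt_add_left (h₂ b hb) _

/-- The rooted insertion of a spanning tree into a spanning tree is one of the result. -/
theorem IsTreeOriented.rootedInsertion [Finite A]
    {p₁ : OrientedMultigraph (Option A) × Option A} {p₂ : OrientedMultigraph B × B}
    (h₁ : IsTreeOriented p₁) (h₂ : IsTreeOriented p₂)
    {p : OrientedMultigraph (A ⊕ B) × (A ⊕ B)} (hp : p ∈ rootedInsertion p₁ p₂) :
    IsTreeOriented p := by
  obtain ⟨g₁, r₁⟩ := p₁
  obtain ⟨g₂, r₂⟩ := p₂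
  obtain ⟨par₁, q₁, hpar₁, h₁⟩ := h₁
  obtain ⟨par₂, q₂, hpar₂, h₂⟩ := h₂
  dsimp only at hpar₁ h₁ hpar₂ h₂
  subst h₁ h₂
  have : Nonempty (A ⊕ B) := ⟨Sum.inr r₂⟩
  have hl : (fun h => rootedEnds A r₂ (h, true)) =
      fun h => (insertionEnds A B h).map fun x => (x, true) := by
    funext h
    rcases h with _ | a <;> simp
  simp only [rootedInsertion_eq, reconnections_add, Multiset.mem_map, Multiset.mem_bind,
    labelAll, reconnections_map, hl, ← map_reconnections] at hp
  obtain ⟨_, ⟨t, ht, _, ⟨q, hq, rfl⟩, rfl⟩, rfl⟩ := hp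
  obtain ⟨c, hc, rfl⟩ := exists_of_mem_reconnections_map (nodup_nonRoots r₁) ht
  have hc' : ∀ v, ∃ x, v ≠ r₁ → x ∈ insertionEnds A B (par₁ v) ∧
      c v = s((x, true), (newRoot r₂ v, false)) := by
    intro v
    by_cases hv : v = r₁
    · exact ⟨Sum.inr r₂, fun h => (h hv).elim⟩
    obtain ⟨y, hy, z, hz, hyz⟩ := mem_reconnect_mk.1 (hc v (mem_nonRoots.2 hv))
    have h1 : rootedEnds A r₂ (v, false) = {(newRoot r₂ v, false)} := by
      rcases v with _ | a <;> rfl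
    rw [h1, Multiset.mem_singleton] at hz
    rw [congrFun hl (par₁ v)] at hy
    obtain ⟨x, hx, rfl⟩ := Multiset.mem_map.1 hy
    exact ⟨x, fun _ => ⟨hx, by rw [← hyz, hz]⟩⟩
  choose x hx using hc'
  refine ⟨insertedParent par₂ r₂ x, q + q₂.map (Sym2.map Sum.inr),
    isParent_insertedParent hpar₁ hpar₂ fun v hv => (hx v hv).1, ?_⟩
  have e1 : (nonRoots r₁).map c = (nonRoots r₁).map fun v =>
      s((insertedParent par₂ r₂ x (newRoot r₂ v), true), (newRoot r₂ v, false)) := by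
    refine Multiset.map_congr rfl fun v hv => ?_
    rw [(hx v (mem_nonRoots.1 hv)).2]
    rcases v with _ | a <;> simp [insertedParent]
  have e2 : (orientedTreeOf r₂ par₂).map (Sym2.map (Prod.map (Sum.inr : B → A ⊕ B) id)) =
      (nonRoots r₂).map fun v =>
        s((insertedParent par₂ r₂ x (Sum.inr v), true), (Sum.inr v, false)) := by
    rw [orientedTreeOf, Multiset.map_map]
    refine Multiset.map_congr rfl fun v hv => ?_
    simp [insertedParent, mem_nonRoots.1 hv]
  have e3 : orientedTreeOf (newRoot r₂ r₁) (insertedParent par₂ r₂ x) =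
      (nonRoots r₁).map c +
        (orientedTreeOf r₂ par₂).map (Sym2.map (Prod.map (Sum.inr : B → A ⊕ B) id)) := by
    rw [e1, e2, orientedTreeOf, nonRoots_newRoot, Multiset.map_add, Multiset.map_map,
      Multiset.map_map]
    rfl
  simp only [e3, labelAll, Multiset.map_add, Multiset.map_map, Function.comp_def, Sym2.map_map,
    Prod.map_def, id]
  abel

end

/-! ### Underlying multigraphs of an insertion -/

section

variable {A B : Type u} [Finite B]

omit [Finite B] in
theorem underlying_map {H : Type u} (f : B → H) (p : OrientedMultigraph B) :
    OrientedMultigraph.underlying (p.map (Sym2.map (Prod.map f id))) =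
      p.underlying.map (Sym2.map f) := by
  simp [OrientedMultigraph.underlying, Multiset.map_map, Sym2.map_map]

theorem map_underlying_reconnections (r : B) (p : OrientedMultigraph (Option A)) :
    (reconnections (rootedEnds A r) p).map OrientedMultigraph.underlying =
      reconnections (fun a => (rootedEnds A r a).map Prod.fst) p :=
  map_reconnections _ _ _

theorem underlying_mem_insertion {p₁ : OrientedMultigraph (Option A) × Option A}
    {p₂ : OrientedMultigraph B × B} {p : OrientedMultigraph (A ⊕ B) × (A ⊕ B)}
    (hp : p ∈ rootedInsertion p₁ p₂) :
    p.1.underlying ∈ insertion p₁.1.underlying p₂.1.underlying := by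
  rw [rootedInsertion_eq] at hp
  obtain ⟨h, hh, rfl⟩ := Multiset.mem_map.1 hp
  rw [insertion_eq, Multiset.mem_map]
  refine ⟨OrientedMultigraph.underlying h, ?_, by rw [underlying_add, underlying_map]⟩
  have := Multiset.mem_map_of_mem OrientedMultigraph.underlying hh
  rw [map_underlying_reconnections] at this
  rw [OrientedMultigraph.underlying, reconnections_map]
  refine mem_reconnections_of_le ?_ this
  rintro ⟨_ | a, _ | _⟩ x <;> simp +contextual [eq_comm]

/-- Without unlabelled ends at `∗`, the reconnections of the ends at `∗` are arbitrary. -/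
theorem map_underlying_reconnections_of_labelled (r : B) {p : OrientedMultigraph (Option A)}
    (hp : ∀ z ∈ p, (none, false) ∉ z) :
    (reconnections (rootedEnds A r) p).map OrientedMultigraph.underlying =
      reconnections (insertionEnds A B) p.underlying := by
  rw [map_underlying_reconnections, OrientedMultigraph.underlying, reconnections_map]
  refine reconnections_congr fun z hz a ha => ?_
  rcases a with ⟨_ | a, _ | _⟩
  · exact (hp z hz ha).elim
  all_goals simp

theorem notMem_labelAll {V : Type u} (q : Multigraph V) (v : V) :
    ∀ z ∈ labelAll q, (v, false) ∉ z := by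
  intro z hz
  obtain ⟨e, he, rfl⟩ := Multiset.mem_map.1 hz
  simp [Sym2.mem_map]

variable [Finite A]

/-- If the root is `∗`, all ends at `∗` are labelled. -/
theorem map_underlying_rootedInsertion_none {g₁ : OrientedMultigraph (Option A)}
    (h₁ : IsTreeOriented (g₁, none)) (p₂ : OrientedMultigraph B × B) :
    (rootedInsertion (g₁, none) p₂).map (fun p => (p.1.underlying, p.2)) =
      (insertion g₁.underlying p₂.1.underlying).map fun g => (g, Sum.inr p₂.2) := by
  obtain ⟨par₁, q₁, hpar₁, h⟩ := h₁
  have : ∀ z ∈ g₁, (none, false) ∉ z := by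
    change g₁ = _ at h
    rw [h]
    intro z hz
    rcases Multiset.mem_add.1 hz with hz | hz
    · obtain ⟨v, hv, rfl⟩ := Multiset.mem_map.1 hz
      have := mem_nonRoots.1 hv
      simp [this.symm]
    · exact notMem_labelAll q₁ _ z hz
  rw [insertion_eq, ← map_underlying_reconnections_of_labelled p₂.2 this, rootedInsertion_eq]
  simp only [Multiset.map_map, Function.comp_def, underlying_add, underlying_map]
  rfl

/-- If the root is not `∗`, exactly one end at `∗` is unlabelled; moving it to the root `r₂` for
all `r₂` amounts to moving it to an arbitrary vertex. -/
theorem map_underlying_rootedInsertion_some {g₁ : OrientedMultigraph (Option A)} {r : A}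
    (h₁ : IsTreeOriented (g₁, some r)) {g₂ : Multigraph B} {p₂ : B → OrientedMultigraph B}
    (hp₂ : ∀ b, (p₂ b).underlying = g₂) :
    ((allOf B).bind fun b => (rootedInsertion (g₁, some r) (p₂ b, b)).map
        fun p => (p.1.underlying, p.2)) =
      (insertion g₁.underlying g₂).map fun g => (g, Sum.inl r) := by
  obtain ⟨par₁, q₁, hpar₁, h⟩ := h₁
  change g₁ = _ at h
  obtain ⟨s, hs⟩ : ∃ s, nonRoots (some r) = none ::ₘ s :=
    Multiset.exists_cons_of_mem (by simp)
  have hnd := nodup_nonRoots (some r)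
  rw [hs, Multiset.nodup_cons] at hnd
  obtain ⟨a, ha⟩ : ∃ a, par₁ none = some a :=
    Option.ne_none_iff_exists'.1 (hpar₁.ne (by simp))
  obtain ⟨p, hp, hpl⟩ : ∃ p : OrientedMultigraph (Option A),
      g₁ = s((some a, true), (none, false)) ::ₘ p ∧ ∀ z ∈ p, (none, false) ∉ z := by
    refine ⟨(s.map fun v => s((par₁ v, true), (v, false))) + labelAll q₁, ?_, ?_⟩
    · rw [h, orientedTreeOf]
      dsimp only
      rw [hs, Multiset.map_cons, ha, Multiset.cons_add]
    · intro z hz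
      rcases Multiset.mem_add.1 hz with hz | hz
      · obtain ⟨v, hv, rfl⟩ := Multiset.mem_map.1 hz
        have : none ≠ v := fun h => hnd.1 (h ▸ hv)
        simp [this]
      · exact notMem_labelAll q₁ _ z hz
  have hu : g₁.underlying = s(some a, none) ::ₘ p.underlying := by
    rw [hp]
    simp [OrientedMultigraph.underlying]
  rw [hu, insertion_eq, reconnections_cons, reconnect_mk]
  have : ∀ b, (rootedInsertion (g₁, some r) (p₂ b, b)).map (fun p => (p.1.underlying, p.2)) =
      (reconnections (insertionEnds A B) p.underlying).map fun h =>
        (s(Sum.inl a, Sum.inr b) ::ₘ h + g₂.map (Sym2.map Sum.inr), Sum.inl r) := by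
    intro b
    rw [rootedInsertion_eq, hp, reconnections_cons, reconnect_mk,
      ← map_underlying_reconnections_of_labelled b hpl]
    simp only [rootedEnds_some, rootedEnds_none_false, Multiset.singleton_bind,
      Multiset.map_singleton, Multiset.map_map, Function.comp_def, underlying_add,
      underlying_map, hp₂]
    simp [OrientedMultigraph.underlying]
  simp only [this, insertionEnds_some, insertionEnds_none, Multiset.singleton_bind,
    Multiset.map_map, Multiset.bind_map, Multiset.map_bind, Function.comp_def]

theorem connected_of_mem_insertion {g₁ : Multigraph (Option A)} {g₂ : Multigraph B}
    (h₁ : g₁.Connected) (h₂ : g₂.Connected) {g : Multigraph (A ⊕ B)} (hg : g ∈ insertion g₁ g₂) :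
    g.Connected := by
  obtain ⟨t₁, ht₁⟩ := h₁.exists_spanningTree
  obtain ⟨t₂, ht₂⟩ := h₂.exists_spanningTree
  obtain ⟨r⟩ := h₂.nonempty
  have h := map_underlying_rootedInsertion_none (isTreeOriented_orient ht₁ none)
    (orient g₂ t₂ r, r)
  simp only [underlying_orient ht₁.2, underlying_orient ht₂.2] at h
  have hmem := Multiset.mem_map_of_mem (fun g => (g, (Sum.inr r : A ⊕ B))) hg
  rw [← h] at hmem
  obtain ⟨p, hp, he⟩ := Multiset.mem_map.1 hmem
  rw [← show p.1.underlying = g from (Prod.ext_iff.1 he).1]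
  exact ((isTreeOriented_orient ht₁ none).rootedInsertion
    (isTreeOriented_orient ht₂ r) hp).connected

omit [Finite A] in
theorem card_of_mem_insertion {g₁ : Multigraph (Option A)} {g₂ : Multigraph B}
    {g : Multigraph (A ⊕ B)} (hg : g ∈ insertion g₁ g₂) :
    Multiset.card g = Multiset.card g₁ + Multiset.card g₂ := by
  rw [insertion_eq] at hg
  obtain ⟨h, hh, rfl⟩ := Multiset.mem_map.1 hg
  have := Multiset.card_eq_card_of_rel (Multiset.mem_sections.1 hh)
  rw [Multiset.card_map] at this
  rw [Multiset.card_add, Multiset.card_map, this]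

theorem isTree_of_mem_insertion {g₁ : Multigraph (Option A)} {g₂ : Multigraph B}
    (h₁ : g₁.IsTree) (h₂ : g₂.IsTree) {g : Multigraph (A ⊕ B)} (hg : g ∈ insertion g₁ g₂) :
    g.IsTree := by
  rw [Multigraph.isTree_iff] at *
  refine ⟨connected_of_mem_insertion h₁.1 h₂.1 hg, ?_⟩
  have e₁ := h₁.2
  have e₂ := h₂.2
  rw [Finite.card_option] at e₁
  rw [card_of_mem_insertion hg, Nat.card_sum]
  omega

omit [Finite A] in
theorem isGraph_of_mem_insertion {g₁ : Multigraph (Option A)} {g₂ : Multigraph B}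
    (h₁ : g₁.IsGraph) (h₂ : g₂.IsGraph) {g : Multigraph (A ⊕ B)} (hg : g ∈ insertion g₁ g₂) :
    g.IsGraph := by
  rw [insertion_eq] at hg
  obtain ⟨h, hh, rfl⟩ := Multiset.mem_map.1 hg
  rcases isEmpty_or_nonempty (A ⊕ B) with hE | hE
  · have h0 : ∀ g : Multigraph (A ⊕ B), g = 0 := fun g =>
      Multiset.eq_zero_of_forall_notMem fun e => e.ind fun a => (hE.false a).elim
    rw [h0 (_ + _)]
    exact ⟨Multiset.nodup_zero, by simp⟩
  rw [← Multiset.map_id g₁] at hh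
  obtain ⟨c, hc, rfl⟩ := exists_of_mem_reconnections_map h₁.1 hh
  -- The edge `e` is recovered from `c e` by collapsing the vertices of `g₂` to `∗`.
  let ρ : A ⊕ B → Option A := Sum.elim some fun _ => none
  have hρ : ∀ a, ∀ x ∈ insertionEnds A B a, ρ x = a := by
    rintro (_ | a) x hx
    · obtain ⟨b, -, rfl⟩ := Multiset.mem_map.1 hx
      rfl
    · rw [Multiset.mem_singleton.1 hx]
      rfl
  have hc' : ∀ e ∈ g₁, (c e).map ρ = e := by
    intro e he
    have := hc e he
    induction e with | _ a b =>
    obtain ⟨x, hx, y, hy, hxy⟩ := mem_reconnect_mk.1 this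
    rw [← hxy, Sym2.map_mk, hρ a x hx, hρ b y hy]
  refine ⟨?_, ?_⟩
  · rw [Multiset.nodup_add]
    refine ⟨h₁.1.map_on fun e he e' he' hee => ?_,
      h₂.1.map (Sym2.map.injective Sum.inr_injective), ?_⟩
    · rw [← hc' e he, hee, hc' e' he']
    · rw [Multiset.disjoint_left]
      intro z hz hz'
      obtain ⟨e, he, rfl⟩ := Multiset.mem_map.1 hz
      obtain ⟨e', he', h⟩ := Multiset.mem_map.1 hz'
      refine h₁.2 e he ?_
      rw [← hc' e he, ← h]
      induction e' with | _ a b => simp [ρ]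
  · intro z hz
    rcases Multiset.mem_add.1 hz with hz | hz
    · obtain ⟨e, he, rfl⟩ := Multiset.mem_map.1 hz
      intro hd
      refine h₁.2 e he ?_
      rw [← hc' e he]
      exact hd.map
    · obtain ⟨e, he, rfl⟩ := Multiset.mem_map.1 hz
      rw [Sym2.isDiag_map Sum.inr_injective]
      exact h₂.2 e he

/-- The insertion of a sum over all roots into a sum over all roots is, on underlying multigraphs,
the sum over all roots of the insertion. -/
theorem sum_roots_rootedInsertion {g₁ : Multigraph (Option A)} {g₂ : Multigraph B}
    {p₁ : Option A → OrientedMultigraph (Option A)} {p₂ : B → OrientedMultigraph B}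
    (h₁ : ∀ r, IsTreeOriented (p₁ r, r)) (hp₁ : ∀ r, (p₁ r).underlying = g₁)
    (hp₂ : ∀ r, (p₂ r).underlying = g₂) :
    ((allOf (Option A)).bind fun r₁ => (allOf B).bind fun r₂ =>
        (rootedInsertion (p₁ r₁, r₁) (p₂ r₂, r₂)).map fun p => (p.1.underlying, p.2)) =
      (insertion g₁ g₂).bind fun g => (allOf (A ⊕ B)).map fun r => (g, r) := by
  have e1 := map_underlying_rootedInsertion_none (B := B) (h₁ none)
  have e2 := fun a => map_underlying_rootedInsertion_some (h₁ (some a)) hp₂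
  simp only [hp₁] at e1 e2
  simp only [allOf_option, Multiset.cons_bind, Multiset.bind_map, e1, e2, hp₂, allOf_sum,
    Multiset.map_add, Multiset.map_map, Function.comp_def, Multiset.bind_add]
  rw [Multiset.bind_map_comm, add_comm, Multiset.bind_map_comm]

end

/-! ### Suboperads spanned by multigraphs -/

section

variable {V W : Type u} [Finite V] [Finite W]

theorem Multigraph.Connected.map {g : Multigraph V} (h : g.Connected) (σ : V ≃ W) :
    Multigraph.Connected (g.map (Sym2.map σ)) := by
  obtain ⟨t, ht⟩ := h.exists_spanningTree
  obtain ⟨r⟩ := h.nonempty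
  have := ((isTreeOriented_orient ht r).map σ).connected
  rwa [underlying_map, underlying_orient ht.2] at this

omit [Finite V] [Finite W] in
theorem Multigraph.IsGraph.map {g : Multigraph V} (h : g.IsGraph) (σ : V ≃ W) :
    Multigraph.IsGraph (g.map (Sym2.map σ)) := by
  refine ⟨h.1.map (Sym2.map.injective σ.injective), fun e he => ?_⟩
  obtain ⟨e', he', rfl⟩ := Multiset.mem_map.1 he
  rw [Sym2.isDiag_map σ.injective]
  exact h.2 e' he'

theorem Multigraph.IsTree.map {g : Multigraph V} (h : g.IsTree) (σ : V ≃ W) :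
    Multigraph.IsTree (g.map (Sym2.map σ)) := by
  rw [isTree_iff] at *
  exact ⟨h.1.map σ, by rw [Multiset.card_map, h.2, Nat.card_congr σ]⟩

theorem isTreeOriented_one :
    IsTreeOriented ((0 : OrientedMultigraph PUnit.{u + 1}), PUnit.unit) := by
  refine ⟨id, 0, ⟨fun _ => 0, fun v hv => (hv rfl).elim⟩, ?_⟩
  have h : nonRoots PUnit.unit.{u + 1} = 0 :=
    Multiset.eq_zero_of_forall_notMem fun v hv => mem_nonRoots.1 hv rfl
  simp [orientedTreeOf, labelAll, h]

theorem isTree_one : Multigraph.IsTree (0 : Multigraph PUnit.{u + 1}) := by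
  rw [Multigraph.isTree_iff]
  exact ⟨isTreeOriented_one.connected, by simp⟩

end

section

variable {K : Type v} [Field K]

theorem isSuboperad_supported_multigraphs {S : ∀ (V : Type u) [Finite V], Set (Multigraph V)}
    (map : ∀ {V W : Type u} [Finite V] [Finite W] (σ : V ≃ W), ∀ g ∈ S V,
      Multiset.map (Sym2.map σ) g ∈ S W)
    (one : (0 : Multigraph PUnit.{u + 1}) ∈ S PUnit.{u + 1})
    (comp : ∀ {A B : Type u} [Finite A] [Finite B], ∀ g₁ ∈ S (Option A), ∀ g₂ ∈ S B,
      ∀ g ∈ insertion g₁ g₂, g ∈ S (A ⊕ B)) :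
    (multigraphs.{u, v} K).IsSuboperad fun V _ => Finsupp.supported K K (S V) := by
  simp only [Finsupp.supported_eq_span_single]
  refine OperadData.isSuboperad_span (P := multigraphs.{u, v} K)
    (fun V _ => (fun g => Finsupp.single g (1 : K)) '' S V) ?_ ⟨0, one, rfl⟩ ?_
  · rintro V W _ _ σ _ ⟨g, hg, rfl⟩
    exact ⟨_, map σ g hg, (multigraphs_map_single σ g).symm⟩
  · rintro A B _ _ _ ⟨g₁, hg₁, rfl⟩ _ ⟨g₂, hg₂, rfl⟩
    rw [multigraphs_comp_single]
    refine Eq.mp ?_ (formalSum_mem_supported (K := K) (comp g₁ hg₁ g₂ hg₂))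
    rw [Finsupp.supported_eq_span_single]
    rfl

theorem isSuboperad_supported_rootedMultigraphs
    {S : ∀ (V : Type u) [Finite V], Set (OrientedMultigraph V × V)}
    (map : ∀ {V W : Type u} [Finite V] [Finite W] (σ : V ≃ W), ∀ p ∈ S V,
      (Multiset.map (Sym2.map (Prod.map σ id)) p.1, σ p.2) ∈ S W)
    (one : ((0 : OrientedMultigraph PUnit.{u + 1}), PUnit.unit) ∈ S PUnit.{u + 1})
    (comp : ∀ {A B : Type u} [Finite A] [Finite B], ∀ p₁ ∈ S (Option A), ∀ p₂ ∈ S B,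
      ∀ p ∈ rootedInsertion p₁ p₂, p ∈ S (A ⊕ B)) :
    (rootedMultigraphs.{u, v} K).IsSuboperad fun V _ => Finsupp.supported K K (S V) := by
  simp only [Finsupp.supported_eq_span_single]
  refine OperadData.isSuboperad_span (P := rootedMultigraphs.{u, v} K)
    (fun V _ => (fun g => Finsupp.single g (1 : K)) '' S V) ?_ ⟨_, one, rfl⟩ ?_
  · rintro V W _ _ σ _ ⟨g, hg, rfl⟩
    exact ⟨_, map σ g hg, (rootedMultigraphs_map_single σ g).symm⟩
  · rintro A B _ _ _ ⟨g₁, hg₁, rfl⟩ _ ⟨g₂, hg₂, rfl⟩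
    rw [rootedMultigraphs_comp_single]
    refine Eq.mp ?_ (formalSum_mem_supported (K := K) (comp g₁ hg₁ g₂ hg₂))
    rw [Finsupp.supported_eq_span_single]
    rfl

variable (K)

theorem isSuboperad_MGc : (multigraphs.{u, v} K).IsSuboperad (MGc K) :=
  isSuboperad_supported_multigraphs (S := fun V _ => {g : Multigraph V | g.Connected})
    (fun σ _ hg => hg.map σ) isTree_one.2.1
    fun _ h₁ _ h₂ _ hg => connected_of_mem_insertion h₁ h₂ hg

theorem isSuboperad_Gc : (multigraphs.{u, v} K).IsSuboperad (Gc K) :=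
  isSuboperad_supported_multigraphs (S := fun V _ => {g : Multigraph V | g.IsGraph ∧ g.Connected})
    (fun σ _ hg => ⟨hg.1.map σ, hg.2.map σ⟩) ⟨isTree_one.1, isTree_one.2.1⟩
    fun _ h₁ _ h₂ _ hg =>
      ⟨isGraph_of_mem_insertion h₁.1 h₂.1 hg, connected_of_mem_insertion h₁.2 h₂.2 hg⟩

theorem isSuboperad_T : (multigraphs.{u, v} K).IsSuboperad (T K) :=
  isSuboperad_supported_multigraphs (S := fun V _ => {g : Multigraph V | g.IsTree})
    (fun σ _ hg => hg.map σ) isTree_one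
    fun _ h₁ _ h₂ _ hg => isTree_of_mem_insertion h₁ h₂ hg

/-- The linear species of the rooted oriented multigraphs which come from spanning trees. -/
def TreeOriented : (rootedMultigraphs.{u, v} K).Family :=
  fun V _ => Finsupp.supported K K {p : OrientedMultigraph V × V | IsTreeOriented p}

theorem isSuboperad_TreeOriented : (rootedMultigraphs.{u, v} K).IsSuboperad (TreeOriented K) :=
  isSuboperad_supported_rootedMultigraphs
    (S := fun V _ => {p : OrientedMultigraph V × V | IsTreeOriented p})
    (fun σ _ hg => hg.map σ) isTreeOriented_one
    fun _ h₁ _ h₂ _ hg => h₁.rootedInsertion h₂ hg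

theorem isSuboperad_Gorc : (rootedMultigraphs.{u, v} K).IsSuboperad (Gorc K) :=
  isSuboperad_supported_rootedMultigraphs
    (S := fun V _ => {p : OrientedMultigraph V × V |
      p.1.underlying.IsGraph ∧ p.1.underlying.Connected})
    (fun σ p hp => by
      simp only [Set.mem_ofPred_eq, underlying_map]
      exact ⟨hp.1.map σ, hp.2.map σ⟩)
    ⟨isTree_one.1, isTree_one.2.1⟩
    fun _ h₁ _ h₂ _ hg =>
      ⟨isGraph_of_mem_insertion h₁.1 h₂.1 (underlying_mem_insertion hg),
        connected_of_mem_insertion h₁.2 h₂.2 (underlying_mem_insertion hg)⟩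

/-- The rooted trees are the tree-oriented multigraphs with the least number of edges. -/
theorem PLie_eq (V : Type u) [Finite V] : PLie.{u, v} K V =
    Finsupp.supported K K {p : OrientedMultigraph V × V |
      IsTreeOriented p ∧ Multiset.card p.1 + 1 = Nat.card V} := by
  simp only [PLie, exists_orientTree_iff]
  rfl

theorem PLie_le_TreeOriented (V : Type u) [Finite V] : PLie.{u, v} K V ≤ TreeOriented K V := by
  rw [PLie_eq]
  exact Finsupp.supported_mono fun _ h => h.1

theorem isSuboperad_PLie : (rootedMultigraphs.{u, v} K).IsSuboperad (PLie K) := by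
  have : PLie.{u, v} K = fun V [Finite V] => Finsupp.supported K K {p : OrientedMultigraph V × V |
      IsTreeOriented p ∧ Multiset.card p.1 + 1 = Nat.card V} := by
    funext V _
    exact PLie_eq K V
  rw [this]
  refine isSuboperad_supported_rootedMultigraphs (S := fun V _ => {p : OrientedMultigraph V × V |
      IsTreeOriented p ∧ Multiset.card p.1 + 1 = Nat.card V})
    (fun σ p hp => ⟨hp.1.map σ, ?_⟩) ⟨isTreeOriented_one, by simp⟩
    fun p₁ h₁ p₂ h₂ p hp => ⟨h₁.1.rootedInsertion h₂.1 hp, ?_⟩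
  · rw [Multiset.card_map, hp.2, Nat.card_congr σ]
  · have e₁ := h₁.2
    have e₂ := h₂.2
    have e := card_of_mem_insertion (underlying_mem_insertion hp)
    simp only [card_underlying] at e
    rw [Finite.card_option] at e₁
    rw [e, Nat.card_sum]
    omega

end

/-! ### The sum over all roots -/

/-- The kernel of a linearized map `f` is spanned by the differences of elements with the same
image. -/
theorem mem_span_sub_of_mapDomain_eq_zero {K : Type*} [Field K] {X Y : Type*} {S : Set X}
    {f : X → Y} {x : X →₀ K} (hx : x ∈ Finsupp.supported K K S) (h : Finsupp.mapDomain f x = 0) :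
    x ∈ Submodule.span K {z : X →₀ K | ∃ a ∈ S, ∃ b ∈ S, f a = f b ∧
      z = Finsupp.single a 1 - Finsupp.single b 1} := by
  rcases S.eq_empty_or_nonempty with rfl | ⟨a₀, -⟩
  · rw [Finsupp.supported_empty, Submodule.mem_bot] at hx
    rw [hx]
    exact zero_mem _
  have : Nonempty X := ⟨a₀⟩
  -- `s` chooses a representative in `S` of each value of `f` on `S`.
  let s := Function.invFunOn f S
  have key : ∀ x ∈ Finsupp.supported K K S, x - Finsupp.mapDomain s (Finsupp.mapDomain f x) ∈
      Submodule.span K {z : X →₀ K | ∃ a ∈ S, ∃ b ∈ S, f a = f b ∧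
        z = Finsupp.single a 1 - Finsupp.single b 1} := by
    intro x hx
    rw [Finsupp.supported_eq_span_single] at hx
    induction hx using Submodule.span_induction with
    | zero => simp
    | add x y _ _ hx hy =>
      rw [Finsupp.mapDomain_add, Finsupp.mapDomain_add, add_sub_add_comm]
      exact add_mem hx hy
    | smul c x _ hx =>
      rw [Finsupp.mapDomain_smul, Finsupp.mapDomain_smul, ← smul_sub]
      exact Submodule.smul_mem _ c hx
    | mem x hx =>
      obtain ⟨a, ha, rfl⟩ := hx
      rw [Finsupp.mapDomain_single, Finsupp.mapDomain_single]
      have hex : ∃ b ∈ S, f b = f a := ⟨a, ha, rfl⟩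
      exact Submodule.subset_span ⟨a, ha, _, Function.invFunOn_mem hex,
        (Function.invFunOn_eq hex).symm, rfl⟩
  simpa [h] using key x hx

section

variable (K : Type v) [Field K] (V : Type u) [Finite V]

/-- Rooted multigraphs, without orientation. -/
abbrev RootedSpace : Type max u v := (Multigraph V × V) →₀ K

/-- Forget the orientation. -/
def forget : (rootedMultigraphs.{u, v} K).obj V →ₗ[K] RootedSpace.{u, v} K V :=
  Finsupp.lmapDomain K K fun p : OrientedMultigraph V × V => (p.1.underlying, p.2)

/-- The sum of `(g, r)` over all `r`. -/
def sumRoots : (multigraphs.{u, v} K).obj V →ₗ[K] RootedSpace.{u, v} K V :=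
  Finsupp.linearCombination K fun g : Multigraph V =>
    formalSum K ((allOf V).map fun r => (g, r))

/-- Forget the root. -/
def forgetRoot : RootedSpace.{u, v} K V →ₗ[K] (multigraphs.{u, v} K).obj V :=
  Finsupp.lmapDomain K K Prod.fst

/-- Forget the orientation and the root, and divide by the number of vertices. -/
def average : (rootedMultigraphs.{u, v} K).obj V →ₗ[K] (multigraphs.{u, v} K).obj V :=
  (Nat.card V : K)⁻¹ • forgetRoot K V ∘ₗ forget K V

/-- The sum of the orientations of a tree over all roots. -/
def orientRoots : (multigraphs.{u, v} K).obj V →ₗ[K] (rootedMultigraphs.{u, v} K).obj V :=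
  Finsupp.linearCombination K fun t : Multigraph V =>
    formalSum K ((allOf V).map fun r => (orientTree t r, r))

variable {K V}

theorem forget_formalSum (s : Multiset (OrientedMultigraph V × V)) :
    forget K V (formalSum K s) = formalSum K (s.map fun p => (p.1.underlying, p.2)) :=
  mapDomain_formalSum _ _

theorem forget_single (p : OrientedMultigraph V × V) :
    forget K V (Finsupp.single p 1) = Finsupp.single (p.1.underlying, p.2) 1 :=
  Finsupp.mapDomain_single

theorem sumRoots_single (g : Multigraph V) :
    sumRoots K V (Finsupp.single g 1) = formalSum K ((allOf V).map fun r => (g, r)) := by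
  refine (Finsupp.linearCombination_single K 1 g).trans (one_smul _ _)

theorem sumRoots_formalSum (s : Multiset (Multigraph V)) :
    sumRoots K V (formalSum K s) = formalSum K (s.bind fun g => (allOf V).map fun r => (g, r)) :=
  linearCombination_formalSum _ _

theorem orientRoots_single (t : Multigraph V) :
    orientRoots K V (Finsupp.single t 1) =
      formalSum K ((allOf V).map fun r => (orientTree t r, r)) := by
  refine (Finsupp.linearCombination_single K 1 t).trans (one_smul _ _)

theorem forget_rootSum {g : Multigraph V} {t : V → Multigraph V} (ht : ∀ r, t r ≤ g) :
    forget K V (rootSum K g t) = sumRoots K V (Finsupp.single g 1) := by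
  rw [rootSum, forget_formalSum, sumRoots_single, Multiset.map_map]
  simp only [Function.comp_def, underlying_orient (ht _)]

theorem forget_orientRoots (x : (multigraphs.{u, v} K).obj V) :
    forget K V (orientRoots K V x) = sumRoots K V x := by
  induction x using multigraphs_induction with
  | zero => simp
  | add x y hx hy => simp [hx, hy]
  | smul c x hx => simp [hx]
  | single g =>
    rw [orientRoots_single, forget_formalSum, sumRoots_single, Multiset.map_map]
    simp only [Function.comp_def, underlying_orientTree]

theorem average_eq (x : (rootedMultigraphs.{u, v} K).obj V) :
    average K V x = (Nat.card V : K)⁻¹ • forgetRoot K V (forget K V x) := rfl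

theorem forgetRoot_sumRoots (y : (multigraphs.{u, v} K).obj V) :
    forgetRoot K V (sumRoots K V y) = (Nat.card V : K) • y := by
  induction y using multigraphs_induction with
  | zero => simp
  | add x y hx hy => rw [map_add, map_add, hx, hy, smul_add]
  | smul c x hx => rw [map_smul, map_smul, hx, smul_comm]
  | single g =>
    let _ := Fintype.ofFinite V
    have hc : Multiset.card (allOf V) = Nat.card V := Nat.card_eq_fintype_card.symm
    rw [sumRoots_single]
    refine (mapDomain_formalSum _ _).trans ?_
    rw [Multiset.map_map, ← hc]
    refine Eq.trans ?_ (formalSum_replicate _ g)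
    congr 1
    exact Multiset.map_const' _ _

theorem average_of_forget_eq [CharZero K] [Nonempty V] {x : (rootedMultigraphs.{u, v} K).obj V}
    {y : (multigraphs.{u, v} K).obj V} (h : forget K V x = sumRoots K V y) :
    average K V x = y := by
  rw [average_eq, h, forgetRoot_sumRoots]
  exact inv_smul_smul₀ (Nat.cast_ne_zero.2 Nat.card_pos.ne') y

instance [IsEmpty V] : Subsingleton ((rootedMultigraphs.{u, v} K).obj V) :=
  inferInstanceAs (Subsingleton ((OrientedMultigraph V × V) →₀ K))

theorem subsingleton_MGc [IsEmpty V] : Subsingleton (MGc.{u, v} K V) := by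
  have : MGc.{u, v} K V = ⊥ := by
    refine eq_bot_iff.2 ?_
    refine le_of_le_of_eq (Finsupp.supported_mono fun g hg => ?_) Finsupp.supported_empty
    exact not_isEmpty_iff.2 (show g.Connected from hg).nonempty ‹_›
  rw [this]
  infer_instance

theorem average_of_forget_eq_of_mem [CharZero K] {x : (rootedMultigraphs.{u, v} K).obj V}
    {y : (multigraphs.{u, v} K).obj V} (hy : y ∈ MGc K V) (h : forget K V x = sumRoots K V y) :
    average K V x = y := by
  rcases isEmpty_or_nonempty V with hV | hV
  · rw [Subsingleton.elim x 0, map_zero]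
    have := subsingleton_MGc (K := K) (V := V)
    exact congrArg Subtype.val (Subsingleton.elim (0 : MGc K V) ⟨y, hy⟩)
  · exact average_of_forget_eq h

theorem forget_map {W : Type u} [Finite W] (σ : V ≃ W) (x : (rootedMultigraphs.{u, v} K).obj V) :
    forget K W ((rootedMultigraphs K).map σ x) =
      Finsupp.mapDomain (Prod.map (Multiset.map (Sym2.map σ)) σ) (forget K V x) := by
  refine Finsupp.mapDomain_comp.symm.trans (Eq.trans ?_ Finsupp.mapDomain_comp)
  congr 1
  funext p
  exact Prod.ext (underlying_map σ p.1) rfl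

theorem sumRoots_map {W : Type u} [Finite W] (σ : V ≃ W) (y : (multigraphs.{u, v} K).obj V) :
    sumRoots K W ((multigraphs K).map σ y) =
      Finsupp.mapDomain (Prod.map (Multiset.map (Sym2.map σ)) σ) (sumRoots K V y) := by
  induction y using multigraphs_induction with
  | zero => simp
  | add x y hx hy => rw [map_add, map_add, map_add, Finsupp.mapDomain_add, hx, hy]
  | smul c x hx => rw [map_smul, map_smul, map_smul, Finsupp.mapDomain_smul, hx]
  | single g =>
    rw [multigraphs_map_single, sumRoots_single, sumRoots_single, mapDomain_formalSum,
      ← allOf_map σ, Multiset.map_map, Multiset.map_map]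
    rfl

/-! ### The species `O₁` and `O₂` -/

/-- Two tree-oriented multigraphs are the same after forgetting the orientation exactly if they come
from two spanning trees of one multigraph. -/
theorem mem_O2_iff {x : (rootedMultigraphs.{u, v} K).obj V} :
    x ∈ O2 K V ↔ x ∈ TreeOriented K V ∧ forget K V x = 0 := by
  constructor
  · intro hx
    suffices O2 K V ≤ TreeOriented K V ⊓ LinearMap.ker (forget K V) from this hx
    refine Submodule.span_le.2 ?_
    rintro _ ⟨g, r, t₁, t₂, hg, ht₁, ht₂, rfl⟩
    refine ⟨sub_mem (Finsupp.single_mem_supported K 1 (isTreeOriented_orient ht₁ r))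
      (Finsupp.single_mem_supported K 1 (isTreeOriented_orient ht₂ r)), ?_⟩
    refine ((forget K V).map_sub _ _).trans ?_
    rw [forget_single, forget_single, underlying_orient ht₁.2, underlying_orient ht₂.2, sub_self]
  · rintro ⟨hx, h⟩
    refine Submodule.span_mono ?_ (mem_span_sub_of_mapDomain_eq_zero hx h)
    rintro _ ⟨p, hp, p', hp', he, rfl⟩
    obtain ⟨t, ht, h⟩ := IsTreeOriented.exists_orient hp
    obtain ⟨t', ht', h'⟩ := IsTreeOriented.exists_orient hp'
    obtain ⟨e, e'⟩ := Prod.ext_iff.1 he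
    dsimp only at e e'
    rw [← e] at ht' h'
    rw [← e'] at h'
    refine ⟨p.1.underlying, p.2, t, t', hp.connected, ht, ht', ?_⟩
    rw [← h, ← h']
    exact congrArg (fun z => Finsupp.single p 1 - Finsupp.single z 1) (Prod.ext rfl e'.symm)

theorem O2_le_O1 : O2.{u, v} K V ≤ O1 K V := by
  classical
  refine Submodule.span_le.2 ?_
  rintro _ ⟨g, r, t₁, t₂, hg, ht₁, ht₂, rfl⟩
  -- Two sums over all roots whose spanning trees differ at the root `r` only.
  have h : ∀ t : Multigraph V, rootSum K g (Function.update (fun _ => t₁) r t) =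
      Finsupp.single (orient g t r, r) 1 +
        formalSum K ((nonRoots r).map fun r => (orient g t₁ r, r)) := by
    intro t
    have hr : allOf V = r ::ₘ nonRoots r := by
      rw [(nodup_allOf V).ext (Multiset.nodup_cons.2 ⟨by simp, nodup_nonRoots r⟩)]
      intro a
      simp [em]
    rw [rootSum, hr, Multiset.map_cons, formalSum_cons, Function.update_self]
    congr 2
    refine Multiset.map_congr rfl fun v hv => ?_
    rw [Function.update_of_ne (mem_nonRoots.1 hv)]
  have hmem : ∀ t : Multigraph V, t.IsSpanningTree g →
      rootSum K g (Function.update (fun _ => t₁) r t) ∈ O1 K V := by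
    intro t ht
    refine Submodule.subset_span ⟨g, _, hg, fun v => ?_, rfl⟩
    rcases eq_or_ne v r with rfl | hv
    · simpa using ht
    · simpa [hv] using ht₁
  have := sub_mem (hmem t₁ ht₁) (hmem t₂ ht₂)
  rw [h, h] at this
  exact Eq.mp (congrArg (· ∈ O1 K V) (add_sub_add_right_eq_sub _ _ _)) this

/-- Every linear combination of connected multigraphs comes from `K O₁`, by an element which
involves no further multigraphs. -/
theorem exists_mem_O1 {S : Set (Multigraph V)} (hS : ∀ g ∈ S, g.Connected)
    {y : (multigraphs.{u, v} K).obj V} (hy : y ∈ Finsupp.supported K K S) :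
    ∃ x ∈ O1 K V, x ∈ Finsupp.supported K K
      {p : OrientedMultigraph V × V | p.1.underlying ∈ S} ∧ forget K V x = sumRoots K V y := by
  rw [Finsupp.supported_eq_span_single] at hy
  induction hy using Submodule.span_induction with
  | zero => exact ⟨0, zero_mem _, zero_mem _, by rw [map_zero]; exact (map_zero _).symm⟩
  | add y y' _ _ hy hy' =>
    obtain ⟨x, hx, hxS, h⟩ := hy
    obtain ⟨x', hx', hxS', h'⟩ := hy'
    refine ⟨x + x', add_mem hx hx', add_mem hxS hxS', ?_⟩
    rw [map_add, h, h']
    exact (map_add _ _ _).symm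
  | smul c y _ hy =>
    obtain ⟨x, hx, hxS, h⟩ := hy
    refine ⟨c • x, Submodule.smul_mem _ c hx, Submodule.smul_mem _ c hxS, ?_⟩
    rw [map_smul, h]
    exact (map_smul _ _ _).symm
  | mem y hy =>
    obtain ⟨g, hg, rfl⟩ := hy
    obtain ⟨t, ht⟩ := (hS g hg).exists_spanningTree
    refine ⟨rootSum K g fun _ => t, Submodule.subset_span ⟨g, _, hS g hg, fun _ => ht, rfl⟩,
      formalSum_mem_supported fun p hp => ?_, forget_rootSum fun _ => ht.2⟩
    obtain ⟨r, -, rfl⟩ := Multiset.mem_map.1 hp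
    rw [Set.mem_ofPred_eq, underlying_orient ht.2]
    exact hg

theorem rootSum_mem_TreeOriented {g : Multigraph V} {t : V → Multigraph V}
    (ht : ∀ r, (t r).IsSpanningTree g) : rootSum K g t ∈ TreeOriented K V := by
  refine formalSum_mem_supported fun p hp => ?_
  obtain ⟨r, -, rfl⟩ := Multiset.mem_map.1 hp
  exact isTreeOriented_orient (ht r) r

/-- Two elements over the same combination of multigraphs differ by an element of `K O₂`, which is
contained in `K O₁`. -/
theorem mem_O1_iff {x : (rootedMultigraphs.{u, v} K).obj V} :
    x ∈ O1 K V ↔ x ∈ TreeOriented K V ∧ ∃ y ∈ MGc K V, forget K V x = sumRoots K V y := by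
  constructor
  · intro hx
    suffices O1 K V ≤ TreeOriented K V ⊓
        ((MGc K V).map (sumRoots K V)).comap (forget K V) by
      obtain ⟨h, y, hy, h'⟩ := this hx
      exact ⟨h, y, hy, h'.symm⟩
    refine Submodule.span_le.2 ?_
    rintro _ ⟨g, t, hg, ht, rfl⟩
    exact ⟨rootSum_mem_TreeOriented ht, Finsupp.single g 1,
      Finsupp.single_mem_supported K 1 hg, (forget_rootSum fun r => (ht r).2).symm⟩
  · rintro ⟨hx, y, hy, h⟩
    obtain ⟨x', hx', -, h'⟩ := exists_mem_O1 (fun g hg => hg) hy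
    suffices x' ∈ TreeOriented K V by
      have := O2_le_O1 (mem_O2_iff.2 ⟨sub_mem hx this, by rw [map_sub, h, h', sub_self]⟩)
      simpa using add_mem this hx'
    refine (Submodule.span_le (p := TreeOriented K V)).2 ?_ hx'
    rintro _ ⟨g, t, hg, ht, rfl⟩
    exact rootSum_mem_TreeOriented ht

variable [CharZero K]

theorem average_mem_MGc {x : (rootedMultigraphs.{u, v} K).obj V} (hx : x ∈ O1 K V) :
    average K V x ∈ MGc K V := by
  obtain ⟨-, y, hy, h⟩ := mem_O1_iff.1 hx
  rwa [average_of_forget_eq_of_mem hy h]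

theorem forget_eq_sumRoots_average {x : (rootedMultigraphs.{u, v} K).obj V} (hx : x ∈ O1 K V) :
    forget K V x = sumRoots K V (average K V x) := by
  obtain ⟨-, y, hy, h⟩ := mem_O1_iff.1 hx
  rw [average_of_forget_eq_of_mem hy h, h]

theorem mem_O2_iff_average {x : (rootedMultigraphs.{u, v} K).obj V} (hx : x ∈ O1 K V) :
    x ∈ O2 K V ↔ average K V x = 0 := by
  rw [mem_O2_iff]
  constructor
  · rintro ⟨-, h⟩
    rw [average_eq, h, map_zero, smul_zero]
  · intro h
    exact ⟨(mem_O1_iff.1 hx).1, by rw [forget_eq_sumRoots_average hx, h, map_zero]⟩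

end

/-! ### The operads `O₁` and `O₁ / O₂` -/

section

variable {K : Type v} [Field K]

theorem forget_rootSum_comp {A B : Type u} [Finite A] [Finite B] {g₁ : Multigraph (Option A)}
    {g₂ : Multigraph B} {t₁ : Option A → Multigraph (Option A)} {t₂ : B → Multigraph B}
    (ht₁ : ∀ r, (t₁ r).IsSpanningTree g₁) (ht₂ : ∀ r, (t₂ r).IsSpanningTree g₂) :
    forget K (A ⊕ B) ((rootedMultigraphs K).comp (rootSum K g₁ t₁) (rootSum K g₂ t₂)) =
      sumRoots K (A ⊕ B)
        ((multigraphs K).comp (Finsupp.single g₁ 1) (Finsupp.single g₂ 1)) := by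
  rw [rootSum, rootSum, rootedMultigraphs_comp_formalSum, multigraphs_comp_single,
    forget_formalSum, sumRoots_formalSum]
  congr 1
  simp only [Multiset.bind_map, Multiset.map_bind]
  exact sum_roots_rootedInsertion (fun r => isTreeOriented_orient (ht₁ r) r)
    (fun r => underlying_orient (ht₁ r).2 r) (fun r => underlying_orient (ht₂ r).2 r)

theorem forget_one : forget K PUnit.{u + 1} (rootedMultigraphs.{u, v} K).one =
    sumRoots K PUnit.{u + 1} (multigraphs K).one := by
  refine (forget_single _).trans ((sumRoots_single _).trans ?_).symm
  rw [allOf_unique, Multiset.map_singleton, formalSum_singleton]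
  rfl

theorem average_mem_Gc {V : Type u} [Finite V] {x : (rootedMultigraphs.{u, v} K).obj V}
    (hx : x ∈ Gorc K V) : average K V x ∈ Gc K V := by
  refine Submodule.smul_mem _ _ ?_
  have : (Gorc K V) ≤ (Gc K V).comap (forgetRoot K V ∘ₗ forget K V) := by
    refine (Finsupp.supported_eq_span_single K _).trans_le (Submodule.span_le.2 ?_)
    rintro _ ⟨p, hp, rfl⟩
    have : forgetRoot K V (forget K V (Finsupp.single p 1)) =
        Finsupp.single p.1.underlying 1 := by
      rw [forget_single]
      exact Finsupp.mapDomain_single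
    exact (congrArg (· ∈ Gc K V) this).mpr (Finsupp.single_mem_supported K 1 hp)
  exact this hx

variable [CharZero K]

omit [CharZero K] in
theorem average_map {V W : Type u} [Finite V] [Finite W] (σ : V ≃ W)
    (x : (rootedMultigraphs.{u, v} K).obj V) :
    average K W ((rootedMultigraphs K).map σ x) = (multigraphs K).map σ (average K V x) := by
  rw [average_eq, average_eq, forget_map, map_smul, Nat.card_congr σ]
  refine congrArg ((Nat.card W : K)⁻¹ • ·) ?_
  exact (Finsupp.mapDomain_comp (g := Prod.fst) (v := forget K V x)
    (f := Prod.map (Multiset.map (Sym2.map σ)) σ)).symm.trans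
      (Finsupp.mapDomain_comp (f := Prod.fst) (v := forget K V x)
        (g := Multiset.map (Sym2.map σ)))

/-- On `K O₁`, the average over the roots is compatible with the compositions. -/
theorem forget_comp {A B : Type u} [Finite A] [Finite B]
    {x : (rootedMultigraphs.{u, v} K).obj (Option A)} {y : (rootedMultigraphs.{u, v} K).obj B}
    (hx : x ∈ O1 K (Option A)) (hy : y ∈ O1 K B) :
    forget K (A ⊕ B) ((rootedMultigraphs K).comp x y) =
      sumRoots K (A ⊕ B)
        ((multigraphs K).comp (average K (Option A) x) (average K B y)) := by
  induction hx, hy using Submodule.span_induction₂ with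
  | zero_left y hy => simp
  | zero_right y hy => simp
  | add_left x y z _ _ _ hx hy => simp [hx, hy]
  | add_right x y z _ _ _ hx hy => simp [hx, hy]
  | smul_left c x y _ _ hx => simp [hx]
  | smul_right c x y _ _ hx => simp [hx]
  | mem_mem x y hx hy =>
    obtain ⟨g₁, t₁, hg₁, ht₁, rfl⟩ := hx
    obtain ⟨g₂, t₂, hg₂, ht₂, rfl⟩ := hy
    have := hg₁.nonempty
    have := hg₂.nonempty
    rw [average_of_forget_eq (forget_rootSum fun r => (ht₁ r).2),
      average_of_forget_eq (forget_rootSum fun r => (ht₂ r).2), forget_rootSum_comp ht₁ ht₂]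

variable (K) in
theorem isSuboperad_O1 : (rootedMultigraphs.{u, v} K).IsSuboperad (O1 K) where
  map_mem σ x hx := by
    obtain ⟨h, y, hy, hxy⟩ := mem_O1_iff.1 hx
    refine mem_O1_iff.2 ⟨(isSuboperad_TreeOriented K).map_mem σ x h,
      (multigraphs K).map σ y, (isSuboperad_MGc K).map_mem σ y hy, ?_⟩
    rw [forget_map, sumRoots_map, hxy]
  one_mem := mem_O1_iff.2 ⟨(isSuboperad_TreeOriented K).one_mem, _,
    (isSuboperad_MGc K).one_mem, forget_one⟩
  comp_mem x y hx hy := mem_O1_iff.2 ⟨(isSuboperad_TreeOriented K).comp_mem x y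
    (mem_O1_iff.1 hx).1 (mem_O1_iff.1 hy).1, _,
    (isSuboperad_MGc K).comp_mem _ _ (average_mem_MGc hx) (average_mem_MGc hy), forget_comp hx hy⟩

variable (K) in
theorem isSuboperad_O1G : (rootedMultigraphs.{u, v} K).IsSuboperad (O1G K) where
  map_mem σ x hx := ⟨(isSuboperad_O1 K).map_mem σ x hx.1, (isSuboperad_Gorc K).map_mem σ x hx.2⟩
  one_mem := ⟨(isSuboperad_O1 K).one_mem, (isSuboperad_Gorc K).one_mem⟩
  comp_mem x y hx hy := ⟨(isSuboperad_O1 K).comp_mem x y hx.1 hy.1,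
    (isSuboperad_Gorc K).comp_mem x y hx.2 hy.2⟩

theorem average_comp {A B : Type u} [Finite A] [Finite B]
    {x : (rootedMultigraphs.{u, v} K).obj (Option A)} {y : (rootedMultigraphs.{u, v} K).obj B}
    (hx : x ∈ O1 K (Option A)) (hy : y ∈ O1 K B) :
    average K (A ⊕ B) ((rootedMultigraphs K).comp x y) =
      (multigraphs K).comp (average K (Option A) x) (average K B y) :=
  average_of_forget_eq_of_mem
    ((isSuboperad_MGc K).comp_mem _ _ (average_mem_MGc hx) (average_mem_MGc hy)) (forget_comp hx hy)

theorem average_one :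
    average K PUnit.{u + 1} (rootedMultigraphs.{u, v} K).one = (multigraphs K).one :=
  average_of_forget_eq forget_one

/-- On a suboperad `N` of `K O₁` the average is a morphism of operads, so that its kernel `I` is an
ideal. -/
theorem isIdeal_of_average {N I : (rootedMultigraphs.{u, v} K).Family}
    (hN : (rootedMultigraphs.{u, v} K).IsSuboperad N)
    (hN1 : ∀ (V : Type u) [Finite V], N V ≤ O1 K V)
    (hI : ∀ (V : Type u) [Finite V], ∀ x ∈ N V, x ∈ I V ↔ average K V x = 0) :
    ((rootedMultigraphs.{u, v} K).sub N hN).IsIdeal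
      ((rootedMultigraphs.{u, v} K).familyIn I N hN) where
  map_mem σ x hx := by
    refine (hI _ _ (hN.map_mem σ x.1 x.2)).2 ?_
    rw [average_map, (hI _ _ x.2).1 hx, map_zero]
  comp_mem_left x y hx := by
    refine (hI _ _ (hN.comp_mem x.1 y.1 x.2 y.2)).2 ?_
    rw [average_comp (hN1 _ x.2) (hN1 _ y.2), (hI _ _ x.2).1 hx, map_zero, LinearMap.zero_apply]
  comp_mem_right x y hy := by
    refine (hI _ _ (hN.comp_mem x.1 y.1 x.2 y.2)).2 ?_
    rw [average_comp (hN1 _ x.2) (hN1 _ y.2), (hI _ _ y.2).1 hy, map_zero]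

omit [CharZero K] in
/-- The first isomorphism theorem for a map from a subspace `N` onto a subspace `M`. -/
theorem exists_equiv_quotient {X Y : Type*} [AddCommGroup X] [Module K X] [AddCommGroup Y]
    [Module K Y] (f : X →ₗ[K] Y) {N I : Submodule K X} {M : Submodule K Y}
    (hI : ∀ x ∈ N, x ∈ I ↔ f x = 0) (hNM : ∀ x ∈ N, f x ∈ M)
    (hMN : ∀ y ∈ M, ∃ x ∈ N, f x = y) :
    ∃ e : M ≃ₗ[K] (N ⧸ I.comap N.subtype), ∀ (x : N) (y : M), f x.1 = y.1 →
      e y = Submodule.Quotient.mk x := by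
  let θ : N →ₗ[K] M := f.restrict hNM
  have hsurj : Function.Surjective θ := by
    rintro ⟨y, hy⟩
    obtain ⟨x, hx, h⟩ := hMN y hy
    exact ⟨⟨x, hx⟩, Subtype.ext h⟩
  have hker : I.comap N.subtype = LinearMap.ker θ := by
    ext x
    rw [LinearMap.mem_ker, Subtype.ext_iff]
    exact hI x.1 x.2
  refine ⟨((Submodule.quotEquivOfEq _ _ hker).trans (θ.quotKerEquivOfSurjective hsurj)).symm,
    fun x y h => ?_⟩
  rw [LinearEquiv.symm_apply_eq]
  exact (Subtype.ext h).symm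

/-- If the average maps a suboperad `N` of `K O₁` onto `M`, with kernel `I`, then it induces an
isomorphism from `N / I` to `M`; here its inverse is given. -/
theorem exists_hom_of_average {M : (multigraphs.{u, v} K).Family}
    {N I : (rootedMultigraphs.{u, v} K).Family}
    (hM : (multigraphs.{u, v} K).IsSuboperad M)
    (hN : (rootedMultigraphs.{u, v} K).IsSuboperad N)
    (hN1 : ∀ (V : Type u) [Finite V], N V ≤ O1 K V)
    (hI : ∀ (V : Type u) [Finite V], ∀ x ∈ N V, x ∈ I V ↔ average K V x = 0)
    (hI' : ((rootedMultigraphs.{u, v} K).sub N hN).IsIdeal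
      ((rootedMultigraphs.{u, v} K).familyIn I N hN))
    (hNM : ∀ (V : Type u) [Finite V], ∀ x ∈ N V, average K V x ∈ M V)
    (hMN : ∀ (V : Type u) [Finite V], ∀ y ∈ M V, ∃ x ∈ N V, average K V x = y) :
    ∃ ψ : ((multigraphs.{u, v} K).sub M hM).Hom
        (((rootedMultigraphs.{u, v} K).sub N hN).quot _ hI'),
      ψ.IsIso ∧ ∀ (V : Type u) [Finite V] (x : N V) (y : M V), average K V x.1 = y.1 →
        ψ.app V y = Submodule.Quotient.mk x := by
  choose e he using fun (V : Type u) [Finite V] =>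
    exists_equiv_quotient (average K V) (hI V) (hNM V) (hMN V)
  have hlift : ∀ (V : Type u) [Finite V] (y : M V), ∃ x : N V, average K V x.1 = y.1 := by
    intro V _ y
    obtain ⟨x, hx, h⟩ := hMN V y.1 y.2
    exact ⟨⟨x, hx⟩, h⟩
  refine ⟨⟨fun V _ => (e V).toLinearMap, ?_, ?_, ?_⟩, fun V _ => (e V).bijective, he⟩
  · intro V W _ _ σ y
    obtain ⟨x, hx⟩ := hlift V y
    refine (he W ⟨_, hN.map_mem σ x.1 x.2⟩ _ ?_).trans
      (congrArg ((((rootedMultigraphs.{u, v} K).sub N hN).quot _ hI').map σ) (he V x y hx)).symm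
    rw [average_map, hx]
    rfl
  · exact he _ ⟨_, hN.one_mem⟩ _ average_one
  · intro A B _ _ y y'
    obtain ⟨x, hx⟩ := hlift _ y
    obtain ⟨x', hx'⟩ := hlift _ y'
    refine (he _ ⟨_, hN.comp_mem x.1 x'.1 x.2 x'.2⟩ _ ?_).trans ?_
    · rw [average_comp (hN1 _ x.2) (hN1 _ x'.2), hx, hx']
      rfl
    · have h := he _ x y hx
      have h' := he _ x' y' hx'
      exact (congrArg₂ (fun a b => (((rootedMultigraphs.{u, v} K).sub N hN).quot _ hI').comp a b)
        h h').symm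

theorem mem_O2G_iff_average {V : Type u} [Finite V] {x : (rootedMultigraphs.{u, v} K).obj V}
    (hx : x ∈ O1G K V) : x ∈ O2G K V ↔ average K V x = 0 :=
  ⟨fun h => (mem_O2_iff_average hx.1).1 h.1, fun h => ⟨(mem_O2_iff_average hx.1).2 h, hx.2⟩⟩

theorem exists_O1_average_eq {V : Type u} [Finite V] {y : (multigraphs.{u, v} K).obj V}
    (hy : y ∈ MGc K V) : ∃ x ∈ O1 K V, average K V x = y := by
  obtain ⟨x, hx, -, h⟩ := exists_mem_O1 (fun g hg => hg) hy
  exact ⟨x, hx, average_of_forget_eq_of_mem hy h⟩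

theorem exists_O1G_average_eq {V : Type u} [Finite V] {y : (multigraphs.{u, v} K).obj V}
    (hy : y ∈ Gc K V) : ∃ x ∈ O1G K V, average K V x = y := by
  obtain ⟨x, hx, hx', h⟩ := exists_mem_O1 (fun g hg => hg.2) hy
  exact ⟨x, ⟨hx, hx'⟩, average_of_forget_eq_of_mem (Gc_le_MGc K V hy) h⟩

/-! ### Trees and the pre-Lie operad -/

omit [CharZero K] in
/-- A rooted tree determines its orientation. -/
theorem eq_of_forget_eq {V : Type u} [Finite V] {x y : (rootedMultigraphs.{u, v} K).obj V}
    (hx : x ∈ PLie K V) (hy : y ∈ PLie K V) (h : forget K V x = forget K V y) : x = y := by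
  refine Finsupp.mapDomain_injOn _ ?_ hx hy h
  rintro p ⟨t, -, hp⟩ p' ⟨t', -, hp'⟩ he
  obtain ⟨e, e'⟩ := Prod.ext_iff.1 he
  dsimp only at e e'
  rw [hp, hp'] at e
  simp only [underlying_orientTree] at e
  rw [hp, hp', e, e']

omit [CharZero K] in
theorem orientRoots_mem_PLie {V : Type u} [Finite V] {y : (multigraphs.{u, v} K).obj V}
    (hy : y ∈ T K V) : orientRoots K V y ∈ PLie K V := by
  have : T K V ≤ (PLie K V).comap (orientRoots K V) := by
    refine (Finsupp.supported_eq_span_single K _).trans_le (Submodule.span_le.2 ?_)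
    rintro _ ⟨t, ht, rfl⟩
    refine (congrArg (· ∈ PLie K V) (orientRoots_single t)).mpr (formalSum_mem_supported ?_)
    intro p hp
    obtain ⟨r, -, rfl⟩ := Multiset.mem_map.1 hp
    exact ⟨t, ht, rfl⟩
  exact this hy

omit [CharZero K] in
theorem orientRoots_mem_O1 {V : Type u} [Finite V] {y : (multigraphs.{u, v} K).obj V}
    (hy : y ∈ T K V) : orientRoots K V y ∈ O1 K V :=
  mem_O1_iff.2 ⟨PLie_le_TreeOriented K V (orientRoots_mem_PLie hy), y, T_le_MGc K V hy,
    forget_orientRoots y⟩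

theorem average_orientRoots {V : Type u} [Finite V] {y : (multigraphs.{u, v} K).obj V}
    (hy : y ∈ T K V) : average K V (orientRoots K V y) = y :=
  average_of_forget_eq_of_mem (T_le_MGc K V hy) (forget_orientRoots y)

omit [CharZero K] in
theorem average_mem_T {V : Type u} [Finite V] {x : (rootedMultigraphs.{u, v} K).obj V}
    (hx : x ∈ PLie K V) : average K V x ∈ T K V := by
  refine Submodule.smul_mem _ _ ?_
  have : (PLie K V) ≤ (T K V).comap (forgetRoot K V ∘ₗ forget K V) := by
    refine (Finsupp.supported_eq_span_single K _).trans_le (Submodule.span_le.2 ?_)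
    rintro _ ⟨p, ⟨t, ht, hp⟩, rfl⟩
    have : forgetRoot K V (forget K V (Finsupp.single p 1)) =
        Finsupp.single p.1.underlying 1 := by
      rw [forget_single]
      exact Finsupp.mapDomain_single
    refine (congrArg (· ∈ T K V) this).mpr (Finsupp.single_mem_supported K 1 ?_)
    rw [hp, underlying_orientTree]
    exact ht
  exact this hx

variable (K) in
/-- The morphism `t ↦ ∑ r, (t_r, r)` from trees to the pre-Lie operad. It is compatible with the
structures since it is so after forgetting the orientations, which is injective on `PLie`. -/
def treeHom : (opT (isSuboperad_T.{u, v} K)).Hom (opPLie (isSuboperad_PLie.{u, v} K)) where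
  app V _ := (orientRoots K V).restrict fun _ hy => orientRoots_mem_PLie hy
  natural {V W} _ _ σ y := by
    refine Subtype.ext (eq_of_forget_eq (orientRoots_mem_PLie ((isSuboperad_T K).map_mem σ _ y.2))
      ((isSuboperad_PLie K).map_mem σ _ (orientRoots_mem_PLie y.2)) ?_)
    refine (forget_orientRoots _).trans (Eq.trans ?_ (forget_map σ _).symm)
    refine (sumRoots_map σ _).trans (congrArg _ (forget_orientRoots _).symm)
  map_one := by
    refine Subtype.ext (eq_of_forget_eq (orientRoots_mem_PLie (isSuboperad_T K).one_mem)
      (isSuboperad_PLie K).one_mem ?_)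
    exact (forget_orientRoots _).trans forget_one.symm
  map_comp {A B} _ _ x y := by
    refine Subtype.ext (eq_of_forget_eq
      (orientRoots_mem_PLie ((isSuboperad_T K).comp_mem _ _ x.2 y.2))
      ((isSuboperad_PLie K).comp_mem _ _ (orientRoots_mem_PLie x.2) (orientRoots_mem_PLie y.2)) ?_)
    refine (forget_orientRoots _).trans (Eq.trans ?_
      (forget_comp (orientRoots_mem_O1 x.2) (orientRoots_mem_O1 y.2)).symm)
    rw [average_orientRoots x.2, average_orientRoots y.2]
    rfl

end

end GraphOperads

end

theorem mainTheorem2 (K : Type v) [Field K] [CharZero K] :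
    ∃ (hMGc : (GraphOperads.multigraphs.{u, v} K).IsSuboperad (GraphOperads.MGc K))
      (hGc : (GraphOperads.multigraphs.{u, v} K).IsSuboperad (GraphOperads.Gc K))
      (hT : (GraphOperads.multigraphs.{u, v} K).IsSuboperad (GraphOperads.T K))
      (hPLie : (GraphOperads.rootedMultigraphs.{u, v} K).IsSuboperad (GraphOperads.PLie K))
      (hO1 : (GraphOperads.rootedMultigraphs.{u, v} K).IsSuboperad (GraphOperads.O1 K))
      (hO2 : ((GraphOperads.rootedMultigraphs.{u, v} K).sub (GraphOperads.O1 K) hO1).IsIdeal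
        (GraphOperads.O2inO1 hO1))
      (hO1G : (GraphOperads.rootedMultigraphs.{u, v} K).IsSuboperad (GraphOperads.O1G K))
      (hO2G : ((GraphOperads.rootedMultigraphs.{u, v} K).sub (GraphOperads.O1G K) hO1G).IsIdeal
        (GraphOperads.O2GinO1G hO1G)),
      -- all the objects involved are operads
      (GraphOperads.opMGc hMGc).IsOperad ∧ (GraphOperads.opGc hGc).IsOperad ∧
      (GraphOperads.opT hT).IsOperad ∧ (GraphOperads.opPLie hPLie).IsOperad ∧
      (GraphOperads.opQ hO1 hO2).IsOperad ∧ (GraphOperads.opQG hO1G hO2G).IsOperad ∧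
      (∀ (V : Type u) [Finite V], GraphOperads.O2.{u, v} K V ≤ GraphOperads.O1 K V) ∧
      ∃ (ψ₀ : (GraphOperads.opT hT).Hom (GraphOperads.opPLie hPLie))
        (ψ : (GraphOperads.opMGc hMGc).Hom (GraphOperads.opQ hO1 hO2))
        (ψG : (GraphOperads.opGc hGc).Hom (GraphOperads.opQG hO1G hO2G)),
        -- `ψ₀` is the monomorphism `t ↦ ∑ r, (t, r)` from trees to the pre-Lie operad,
        -- an isomorphism onto `K O₁ ∩ PLie`
        ψ₀.IsMono ∧
        (∀ (V : Type u) [Finite V] (t : GraphOperads.Multigraph V) (ht : t.IsTree),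
          (ψ₀.app V (GraphOperads.T.of K t ht)).1 =
            GraphOperads.formalSum K
              ((GraphOperads.allOf V).map fun r => (GraphOperads.orientTree t r, r))) ∧
        (∀ (V : Type u) [Finite V],
          (LinearMap.range (ψ₀.app V)).map (GraphOperads.PLie K V).subtype =
            GraphOperads.O1 K V ⊓ GraphOperads.PLie K V) ∧
        -- `ψ` is an isomorphism of operads given by the formula, for any spanning trees
        ψ.IsIso ∧
        (∀ (V : Type u) [Finite V] (g : GraphOperads.Multigraph V) (hg : g.Connected)
          (t : V → GraphOperads.Multigraph V) (ht : ∀ r, (t r).IsSpanningTree g),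
          ψ.app V (GraphOperads.MGc.of K g hg) =
            Submodule.Quotient.mk (GraphOperads.O1.of K g hg t ht)) ∧
        -- `ψ` extends `ψ₀`
        (∀ (V : Type u) [Finite V] (x : GraphOperads.T K V),
          ∃ h : (ψ₀.app V x).1 ∈ GraphOperads.O1 K V,
            ψ.app V (Submodule.inclusion (GraphOperads.T_le_MGc K V) x) =
              Submodule.Quotient.mk ⟨(ψ₀.app V x).1, h⟩) ∧
        -- `ψ` restricts to the isomorphism of operads `ψG`
        ψG.IsIso ∧
        (∀ (V : Type u) [Finite V] (x : GraphOperads.Gc K V),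
          GraphOperads.quotInclusion K V (ψG.app V x) =
            ψ.app V (Submodule.inclusion (GraphOperads.Gc_le_MGc K V) x)) := by

  have hO2' : ∀ (V : Type u) [Finite V], ∀ x ∈ GraphOperads.O1.{u, v} K V,
      x ∈ GraphOperads.O2 K V ↔ GraphOperads.average K V x = 0 :=
    fun V _ x hx => GraphOperads.mem_O2_iff_average hx
  have hO2G' : ∀ (V : Type u) [Finite V], ∀ x ∈ GraphOperads.O1G.{u, v} K V,
      x ∈ GraphOperads.O2G K V ↔ GraphOperads.average K V x = 0 :=
    fun V _ x hx => GraphOperads.mem_O2G_iff_average hx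
  have hO2 := GraphOperads.isIdeal_of_average (GraphOperads.isSuboperad_O1.{u, v} K)
    (fun V _ => le_rfl) hO2'
  have hO2G := GraphOperads.isIdeal_of_average (GraphOperads.isSuboperad_O1G.{u, v} K)
    (fun V _ => inf_le_left) hO2G'
  obtain ⟨ψ, hψ, hψ'⟩ := GraphOperads.exists_hom_of_average (GraphOperads.isSuboperad_MGc K)
    (GraphOperads.isSuboperad_O1.{u, v} K) (fun V _ => le_rfl) hO2' hO2
    (fun V _ x hx => GraphOperads.average_mem_MGc hx)
    (fun V _ y hy => GraphOperads.exists_O1_average_eq hy)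
  obtain ⟨ψG, hψG, hψG'⟩ := GraphOperads.exists_hom_of_average (GraphOperads.isSuboperad_Gc K)
    (GraphOperads.isSuboperad_O1G.{u, v} K) (fun V _ => inf_le_left) hO2G' hO2G
    (fun V _ x hx => GraphOperads.average_mem_Gc hx.2)
    (fun V _ y hy => GraphOperads.exists_O1G_average_eq hy)
  have hsub : ∀ (V : Type u) [Finite V] [IsEmpty V],
      Subsingleton ((GraphOperads.rootedMultigraphs.{u, v} K).obj V) := fun V _ _ => inferInstance
  have hMGc : ∀ (V : Type u) [Finite V] [IsEmpty V], ∀ x ∈ GraphOperads.MGc.{u, v} K V, x = 0 := by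
    intro V _ _ x hx
    have := GraphOperads.subsingleton_MGc (K := K) (V := V)
    exact congrArg Subtype.val
      (Subsingleton.elim (⟨x, hx⟩ : GraphOperads.MGc K V) 0)
  refine ⟨GraphOperads.isSuboperad_MGc K, GraphOperads.isSuboperad_Gc K,
    GraphOperads.isSuboperad_T K, GraphOperads.isSuboperad_PLie K, GraphOperads.isSuboperad_O1 K,
    hO2, GraphOperads.isSuboperad_O1G K, hO2G,
    (GraphOperads.multigraphs_laws.sub _ _).isOperad fun V _ _ => ?_,
    (GraphOperads.multigraphs_laws.sub _ _).isOperad fun V _ _ => ?_,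
    (GraphOperads.multigraphs_laws.sub _ _).isOperad fun V _ _ => ?_,
    (GraphOperads.rootedMultigraphs_laws.sub _ _).isOperad fun V _ _ => ?_,
    ((GraphOperads.rootedMultigraphs_laws.sub _ _).quot _ _).isOperad fun V _ _ => ?_,
    ((GraphOperads.rootedMultigraphs_laws.sub _ _).quot _ _).isOperad fun V _ _ => ?_,
    fun V _ => GraphOperads.O2_le_O1, GraphOperads.treeHom K, ψ, ψG, ?_, ?_, ?_, hψ, ?_, ?_, hψG,
    ?_⟩
  · exact ⟨fun x y => Subtype.ext ((hMGc V _ x.2).trans (hMGc V _ y.2).symm)⟩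
  · exact ⟨fun x y => Subtype.ext ((hMGc V _ (GraphOperads.Gc_le_MGc K V x.2)).trans
      (hMGc V _ (GraphOperads.Gc_le_MGc K V y.2)).symm)⟩
  · exact ⟨fun x y => Subtype.ext ((hMGc V _ (GraphOperads.T_le_MGc K V x.2)).trans
      (hMGc V _ (GraphOperads.T_le_MGc K V y.2)).symm)⟩
  · have := hsub V
    exact ⟨fun x y => Subtype.ext (Subsingleton.elim _ _)⟩
  · have := hsub V
    refine ⟨fun x y => ?_⟩
    obtain ⟨x, rfl⟩ := Submodule.Quotient.mk_surjective _ x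
    obtain ⟨y, rfl⟩ := Submodule.Quotient.mk_surjective _ y
    exact congrArg _ (Subtype.ext (Subsingleton.elim _ _))
  · have := hsub V
    refine ⟨fun x y => ?_⟩
    obtain ⟨x, rfl⟩ := Submodule.Quotient.mk_surjective _ x
    obtain ⟨y, rfl⟩ := Submodule.Quotient.mk_surjective _ y
    exact congrArg _ (Subtype.ext (Subsingleton.elim _ _))
  · intro V _ x y h
    have h' := congrArg (GraphOperads.average K V) (congrArg Subtype.val h)
    exact Subtype.ext (((GraphOperads.average_orientRoots x.2).symm.trans h').trans
      (GraphOperads.average_orientRoots y.2))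
  · exact fun V _ t ht => GraphOperads.orientRoots_single t
  · intro V _
    ext x
    constructor
    · rintro ⟨_, ⟨y, rfl⟩, rfl⟩
      exact ⟨GraphOperads.orientRoots_mem_O1 y.2, GraphOperads.orientRoots_mem_PLie y.2⟩
    · rintro ⟨hx, hx'⟩
      have hy := GraphOperads.average_mem_T hx'
      refine ⟨_, ⟨⟨_, hy⟩, rfl⟩, ?_⟩
      refine GraphOperads.eq_of_forget_eq (GraphOperads.orientRoots_mem_PLie hy) hx' ?_
      exact (GraphOperads.forget_orientRoots _).trans
        (GraphOperads.forget_eq_sumRoots_average hx).symm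
  · intro V _ g hg t ht
    have := hg.nonempty
    exact hψ' V _ _ (GraphOperads.average_of_forget_eq
      (GraphOperads.forget_rootSum fun r => (ht r).2))
  · intro V _ x
    exact ⟨GraphOperads.orientRoots_mem_O1 x.2, hψ' V _ _ (GraphOperads.average_orientRoots x.2)⟩
  · intro V _ y
    obtain ⟨x, hx, h⟩ := GraphOperads.exists_O1G_average_eq y.2
    have e := hψG' V ⟨x, hx⟩ y h
    have e' := hψ' V ⟨x, hx.1⟩ (Submodule.inclusion (GraphOperads.Gc_le_MGc K V) y) h
    exact (congrArg (GraphOperads.quotInclusion K V) e).trans e'.symm
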